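/- Let $X$ be a real vector space, $\mathcal F$ a $\sigma$-algebra on $X$ stable under translations and under dilations of non-zero ratio. For a convex set $C\subset X$ put $M_C(x)=\inf\{t\ge 0 : x\in tC\}\in[0,+\infty]$; $C$ is called internal if $M_C$ is finite everywhere and $C=\{M_C<1\}$, and $\mathcal C_0(\mathcal F)$ denotes the set of internal convex sets belonging to $\mathcal F$. Let $(X,\mathcal C_0,\mathcal F,\tau)$ be a measurable locally convex space: $\mathcal C_0\subset\mathcal C_0(\mathcal F)$ is a non-empty family of symmetric sets, stable under finite intersections and under dilations of non-zero ratio, with $\bigcap_{C\in\mathcal C_0}C=\{0\}$; $\tau$ is the vector space topology on $X$ for which $\mathcal C_0$ is a fundamental system of neighbourhoods of $0$; and every element of the topological dual $X^*$ is $\mathcal F$-measurable. Let $d\ge 1$. A box is a translate $z+\Lambda(n)$ of some $\Lambda(n)=[0,n[^d\cap\mathbb Z^d$, $n\ge 1$, $z\in\mathbb Z^d$. For a box $\Lambda$ and $\sigma\in X^{\mathbb Z^d}$ let $\mathfrak m_\Lambda(\sigma)=|\Lambda|^{-1}\sum_{z\in\Lambda}\sigma(z)$, and for a finite $S\subset\mathbb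 Z^d$ let $\mathcal F_S$ be the $\sigma$-algebra on $X^{\mathbb Z^d}$ generated by the maps $\mathfrak m_\Lambda$, $\Lambda$ a box included in $S$. Let $(\mu_\Lambda)$ be a compatible system of translation invariant probabilities: for every box $\Lambda$, $\mu_\Lambda$ is a probability measure on $\mathcal F_\Lambda$; $\mu_{\Lambda_2}=\mu_{\Lambda_1}$ on $\mathcal F_{\Lambda_1}$ for all boxes $\Lambda_1\subset\Lambda_2$; and $\mu_{\Lambda+z}(A+z)=\mu_\Lambda(A)$ for every box $\Lambda$, every $A\in\mathcal F_\Lambda$ and every $z\in\mathbb Z^d$, where $A+z=\{\sigma(\cdot-z):\sigma\in A\}$. Write $\mathbb P(A)=\mu_\Lambda(A)$ for $A\in\mathcal F_\Lambda$, and similarly for conditional probabilities (inequalities between which hold almost surely). Let $D\subset X$ be convex, and assume that $(\mu_\Lambda)$ is - lower asymptotically decoupled: there are $g,c:\mathbb N^*\to[0,+\infty[$ with $g(m)/m\to0$ and $c(m)/|\Lambda(m)|\to0$ such that, for all $m\ge1$, all finite $S\subset\mathbb Z^d$, all $A\in\mathcal F_{\Lambda(m)}$ and $B\in\mathcal F_S$,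 if the $\ell^\infty$-distance between $S$ and $\Lambda(m)$ is $>g(m)$, then $\mathbb P(A\cap B)\ge e^{-c(m)}\,\mathbb P(A)\,\mathbb P(B)$; - locally controlled: there are $t,\alpha:\mathcal C_0(\mathcal F)\to{]0,+\infty[}$ such that $\mathbb P(\sigma(0)\in t(C)\cdot C\mid\mathcal F_{\Lambda\setminus\{0\}})\ge\alpha(C)$ for all $C\in\mathcal C_0(\mathcal F)$ and all boxes $\Lambda$; - carried by $D^{\mathbb Z^d}$: for every box $\Lambda$ and all $A,B\in\mathcal F_\Lambda$, $A\cap D^{\mathbb Z^d}=B\cap D^{\mathbb Z^d}$ implies $\mu_\Lambda(A)=\mu_\Lambda(B)$; - locally convex-tight on $D$: for every $\gamma>0$ there is $K(\gamma)\in\mathcal F$ such that $K(\gamma)\cap D$ is convex and relatively compact in $X$ and $\mathbb P(\sigma(0)\in K(\gamma)\mid\mathcal F_{\Lambda\setminus\{0\}})\ge1-\gamma$ for every box $\Lambda$ containing $0$. Let $\mu_n=\mu_{\Lambda(n)}\circ\mathfrak m_{\Lambda(n)}^{-1}$ for $n\ge1$, and define the entropy and the pressure, with values in $[-\infty,+\infty]$,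 by $$s(x)=\inf_{C\in\mathcal C_0}\ \liminf_{n\to\infty}\frac1{|\Lambda(n)|}\log\mu_n(x+C)\quad(x\in X),$$ $$p(\lambda)=\limsup_{n\to\infty}\frac1{|\Lambda(n)|}\log\int e^{|\Lambda(n)|\langle\lambda|y\rangle}\,d\mu_n(y)\quad(\lambda\in X^*).$$ Then the entropy is the negative of the Fenchel–Legendre transform of the pressure: $$\forall x\in X\qquad s(x)=\inf_{\lambda\in X^*}\big(p(\lambda)-\langle\lambda|x\rangle\big).$$ -/

import Mathlib

open MeasureTheory Filter Topology
open scoped Pointwise ENNReal NNReal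

section Gauge

variable {X : Type*} [AddCommGroup X] [Module ℝ X]

/-- The gauge `M_C(x) = inf {t ≥ 0 ; x ∈ t C}`, with values in `[0, +∞]`. -/
noncomputable def extGauge (C : Set X) (x : X) : ℝ≥0∞ :=
  ⨅ (t : ℝ≥0) (_ : x ∈ (t : ℝ) • C), (t : ℝ≥0∞)

/-- A convex set is internal if its gauge is finite everywhere and `C = {M_C < 1}`. -/
structure IsInternalConvex (C : Set X) : Prop where
  convex : Convex ℝ C
  gauge_lt_top : ∀ x, extGauge C x < ⊤
  eq_gauge_lt_one : C = {x | extGauge C x < 1}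

/-- `𝒞₀(𝓕)`: the measurable internal convex sets. -/
def measurableInternalConvexes (X : Type*) [AddCommGroup X] [Module ℝ X] [MeasurableSpace X] :
    Set (Set X) :=
  {C | IsInternalConvex C ∧ MeasurableSet C}

/-- `(X, C₀, 𝓕, τ)` is a measurable locally convex space, where `𝓕` and `τ` are the ambient
`MeasurableSpace` and `TopologicalSpace` (to be used with a vector space topology `τ`). -/
structure IsMeasurableLCS [MeasurableSpace X] [TopologicalSpace X] (C₀ : Set (Set X)) :
    Prop where
  measurableSet_vadd : ∀ (a : X) (A : Set X), MeasurableSet A → MeasurableSet (a +ᵥ A)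
  measurableSet_smul : ∀ (r : ℝ) (A : Set X), r ≠ 0 → MeasurableSet A → MeasurableSet (r • A)
  nonempty : C₀.Nonempty
  subset : C₀ ⊆ measurableInternalConvexes X
  symmetric : ∀ C ∈ C₀, -C = C
  inter_mem : ∀ C ∈ C₀, ∀ C' ∈ C₀, C ∩ C' ∈ C₀
  smul_mem : ∀ (r : ℝ), r ≠ 0 → ∀ C ∈ C₀, r • C ∈ C₀
  sInter_eq : ⋂₀ C₀ = {0}
  nhds_zero_basis : (𝓝 (0 : X)).HasBasis (fun C => C ∈ C₀) id
  measurable_dual : ∀ l : X →L[ℝ] ℝ, Measurable l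

end Gauge

/-- A box of `ℤ^d`, given by its lowest corner and its side length `n ≥ 1`. -/
structure LatticeBox (d : ℕ) where
  corner : Fin d → ℤ
  side : ℕ+

/-- The sites of the box: `corner + [0, side[^d`. -/
noncomputable def LatticeBox.sites {d : ℕ} (Λ : LatticeBox d) : Finset (Fin d → ℤ) :=
  Fintype.piFinset fun i => Finset.Ico (Λ.corner i) (Λ.corner i + (Λ.side : ℤ))

/-- `Λ + z`. -/
def LatticeBox.translate {d : ℕ} (Λ : LatticeBox d) (z : Fin d → ℤ) : LatticeBox d :=
  ⟨Λ.corner + z, Λ.side⟩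

/-- `Λ(n) = [0, n[^d`. -/
def LatticeBox.cube (d : ℕ) (n : ℕ+) : LatticeBox d := ⟨0, n⟩

/-- Configurations. They are never used with the product σ-algebra, only with `fieldSigma S`. -/
abbrev Config (d : ℕ) (X : Type*) := (Fin d → ℤ) → X

section Fields

variable {X : Type*} [AddCommGroup X] [Module ℝ X] {d : ℕ}

/-- The empirical mean `𝔪_Λ(σ) = |Λ|⁻¹ ∑_{z ∈ Λ} σ(z)`. -/
noncomputable def empMean (Λ : LatticeBox d) (σ : Config d X) : X :=
  ((Λ.sites.card : ℝ)⁻¹) • ∑ z ∈ Λ.sites, σ z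

/-- `A + z = {σ(· - z) ; σ ∈ A}`. -/
def shiftSet (z : Fin d → ℤ) (A : Set (Config d X)) : Set (Config d X) :=
  (fun (σ : Config d X) (w : Fin d → ℤ) => σ (w - z)) '' A

/-- `D^{ℤ^d}`. -/
def fieldsIn (d : ℕ) (D : Set X) : Set (Config d X) := {σ | ∀ z, σ z ∈ D}

variable [MeasurableSpace X]

/-- `𝓕_S`: the σ-algebra generated by the means `𝔪_Λ` over the boxes `Λ ⊆ S`. -/
@[reducible] noncomputable def fieldSigma (X : Type*) [AddCommGroup X] [Module ℝ X] [MeasurableSpace X] {d : ℕ}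
    (S : Finset (Fin d → ℤ)) : MeasurableSpace (Config d X) :=
  ⨆ (Λ : LatticeBox d) (_ : Λ.sites ⊆ S),
    MeasurableSpace.comap (empMean Λ) (inferInstance : MeasurableSpace X)

/-- A compatible system of translation invariant probabilities `(μ_Λ)` on `X^{ℤ^d}`. -/
structure InvariantSystem (d : ℕ) (X : Type*) [AddCommGroup X] [Module ℝ X]
    [MeasurableSpace X] where
  law : (Λ : LatticeBox d) → @Measure (Config d X) (fieldSigma X Λ.sites)
  law_univ : ∀ Λ, law Λ Set.univ = 1
  compatible : ∀ Λ₁ Λ₂ : LatticeBox d, Λ₁.sites ⊆ Λ₂.sites →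
    ∀ A, MeasurableSet[fieldSigma X Λ₁.sites] A → law Λ₂ A = law Λ₁ A
  invariant : ∀ (Λ : LatticeBox d) (z : Fin d → ℤ),
    ∀ A, MeasurableSet[fieldSigma X Λ.sites] A → law (Λ.translate z) (shiftSet z A) = law Λ A

namespace InvariantSystem

variable (μ : InvariantSystem d X)

/-- The conditional probability `μ_Λ(A | 𝓖)`. -/
noncomputable def condProb (Λ : LatticeBox d) (𝓖 : MeasurableSpace (Config d X))
    (A : Set (Config d X)) : Config d X → ℝ :=
  condExp 𝓖 (μ.law Λ) (A.indicator fun _ => (1 : ℝ))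

/-- The system is carried by a set `E` of configurations. -/
def CarriedBy (E : Set (Config d X)) : Prop :=
  ∀ (Λ : LatticeBox d) (A B : Set (Config d X)),
    MeasurableSet[fieldSigma X Λ.sites] A → MeasurableSet[fieldSigma X Λ.sites] B →
    A ∩ E = B ∩ E → μ.law Λ A = μ.law Λ B

/-- Lower asymptotic decoupling. The probabilities of `A`, `B` and `A ∩ B` are read off in any
box containing all the sites involved. The distance on `Fin d → ℤ` is the sup-norm distance. -/
def LowerAsymptoticallyDecoupled : Prop :=
  ∃ g c : ℕ+ → ℝ, (∀ m, 0 ≤ g m) ∧ (∀ m, 0 ≤ c m) ∧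
    Tendsto (fun m : ℕ+ => g m / (m : ℝ)) atTop (𝓝 0) ∧
    Tendsto (fun m : ℕ+ => c m / ((LatticeBox.cube d m).sites.card : ℝ)) atTop (𝓝 0) ∧
    ∀ (m : ℕ+) (S : Finset (Fin d → ℤ)) (A B : Set (Config d X)),
      MeasurableSet[fieldSigma X (LatticeBox.cube d m).sites] A →
      MeasurableSet[fieldSigma X S] B →
      (∀ s ∈ S, ∀ z ∈ (LatticeBox.cube d m).sites, g m < dist s z) →
      ∀ Λ : LatticeBox d, (LatticeBox.cube d m).sites ⊆ Λ.sites → S ⊆ Λ.sites →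
        ENNReal.ofReal (Real.exp (-c m)) * μ.law Λ A * μ.law Λ B ≤ μ.law Λ (A ∩ B)

/-- Local control: `ℙ(σ(0) ∈ t(C)·C | 𝓕_{Λ ∖ {0}}) ≥ α(C)`, the conditional probability being
computed in any box `Λ'` containing `Λ ∪ {0}`. -/
def LocallyControlled : Prop :=
  ∃ t α : Set X → ℝ, ∀ C ∈ measurableInternalConvexes X, 0 < t C ∧ 0 < α C ∧
    ∀ Λ Λ' : LatticeBox d, Λ.sites ⊆ Λ'.sites → (0 : Fin d → ℤ) ∈ Λ'.sites →
      ∀ᵐ σ ∂(μ.law Λ'),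
        α C ≤ μ.condProb Λ' (fieldSigma X (Λ.sites.erase 0)) {η | η 0 ∈ t C • C} σ

/-- Local convex-tightness on `D`. -/
def LocallyConvexTight [TopologicalSpace X] (D : Set X) : Prop :=
  ∀ γ : ℝ, 0 < γ → ∃ K : Set X, MeasurableSet K ∧ Convex ℝ (K ∩ D) ∧
    IsCompact (closure (K ∩ D)) ∧
    ∀ Λ : LatticeBox d, (0 : Fin d → ℤ) ∈ Λ.sites →
      ∀ᵐ σ ∂(μ.law Λ),
        1 - γ ≤ μ.condProb Λ (fieldSigma X (Λ.sites.erase 0)) {η | η 0 ∈ K} σ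

/-- The Cramér sequence: `μ_n` is the law of `𝔪_{Λ(n)}` under `μ_{Λ(n)}`. -/
noncomputable def cramer (n : ℕ+) : Measure X :=
  @Measure.map (Config d X) X (fieldSigma X (LatticeBox.cube d n).sites) _
    (empMean (LatticeBox.cube d n)) (μ.law (LatticeBox.cube d n))

/-- `s(x) = inf_{C ∈ C₀} liminf_n |Λ(n)|⁻¹ log μ_n(x + C)`. -/
noncomputable def entropy (C₀ : Set (Set X)) (x : X) : EReal :=
  ⨅ C ∈ C₀, liminf (fun n : ℕ+ =>
    ENNReal.log (μ.cramer n (x +ᵥ C)) / ((LatticeBox.cube d n).sites.card : EReal)) atTop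

/-- `p(l) = limsup_n |Λ(n)|⁻¹ log ∫ exp(|Λ(n)| ⟨l|x⟩) dμ_n(x)`. -/
noncomputable def pressure [TopologicalSpace X] (l : X →L[ℝ] ℝ) : EReal :=
  limsup (fun n : ℕ+ =>
    ENNReal.log (∫⁻ x, ENNReal.ofReal
      (Real.exp (((LatticeBox.cube d n).sites.card : ℝ) * l x)) ∂(μ.cramer n))
      / ((LatticeBox.cube d n).sites.card : EReal)) atTop

end InvariantSystem

end Fields

/-!
Cut the cube `Λ(n)` into translates of a large cube `Λ(m)` separated by narrow gaps. By lower
decoupling, the means over these tiles are, up to a factor of rate `o(1)`, at least as likely to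
fall in a given set as independent variables of law `μ_m`, and by local control the spins in the
gaps cost nothing on the exponential scale. Rates for `μ_m` thus pass to `μ_n` for all large `n`,
as in Cramér's theorem.

Fix a continuous seminorm and record in `G ⊆ X × ℝ` the pairs `(y, r)` for which a ball around `y`
of radius less than `1` has exponential rate greater than `r`. Filling proportions `u` and `v` of
the tiles with means near `y₁` and near `y₂` shows that `G` is convex. Tilt `μ_m` by
`exp (|Λ(m)| l)`: the law of large numbers under the tilted law, applied to a finite partition
supplied by tightness, gives points of `G` where `l y + r` comes close to the pressure `p(l)`.
Hence a point `(x, a)` outside the open convex set `G`, separated from it by Hahn–Banach,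
satisfies `p(l) - l x ≤ a` for some `l`. The other inequality is Chernoff's bound.
-/

section Measure

theorem measure_le_of_isSetAlgebra {α : Type*} [mα : MeasurableSpace α] {ν ρ : Measure α}
    [IsFiniteMeasure ν] [IsFiniteMeasure ρ] {𝒜 : Set (Set α)} (h𝒜 : IsSetAlgebra 𝒜)
    (hgen : mα = MeasurableSpace.generateFrom 𝒜) (h : ∀ A ∈ 𝒜, ν A ≤ ρ A) : ν ≤ ρ := by
  refine Measure.le_iff.2 fun B hB => ENNReal.le_of_forall_pos_le_add fun ε hε _ => ?_
  obtain ⟨A, hA, hAB⟩ := (Measure.MeasureDense.of_generateFrom_isSetAlgebra_finite (ν + ρ) h𝒜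
    hgen).approx B hB (measure_ne_top _ _) ε (by positivity)
  rw [Measure.add_apply, ENNReal.ofReal_coe_nnreal] at hAB
  calc ν B ≤ ν A + ν (symmDiff B A) :=
        (measure_mono fun x hx => or_iff_not_imp_left.2 fun h => .inl ⟨hx, h⟩).trans
          (measure_union_le _ _)
    _ ≤ ρ A + ν (symmDiff B A) := add_le_add_left (h A hA) _
    _ ≤ ρ B + ρ (symmDiff B A) + ν (symmDiff B A) := by
        gcongr
        exact (measure_mono fun x hx => or_iff_not_imp_left.2 fun h => .inr ⟨hx, h⟩).trans
          (measure_union_le _ _)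
    _ ≤ ρ B + ε := by
        rw [add_assoc, add_comm (ρ (symmDiff B A))]
        gcongr

variable {ι : Type*} {α : ι → Type*} [∀ i, MeasurableSpace (α i)]

variable (α) in
/-- The sets which depend on finitely or countably many values of each coordinate: the preimages
of subsets of `ι → ℕ` under products of measurable maps to `ℕ`. They form an algebra of sets which
contains the measurable rectangles. -/
def discretelyDeterminedSets : Set (Set (∀ i, α i)) :=
  {B | ∃ ψ : ∀ i, α i → ℕ, (∀ i, Measurable (ψ i)) ∧
    ∃ F : Set (ι → ℕ), B = (fun v i => ψ i (v i)) ⁻¹' F}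

variable (α) in
theorem isSetAlgebra_discretelyDeterminedSets : IsSetAlgebra (discretelyDeterminedSets α) where
  empty_mem := ⟨fun _ _ => 0, fun _ => measurable_const, ∅, rfl⟩
  compl_mem := by
    rintro _ ⟨ψ, hψ, F, rfl⟩
    exact ⟨ψ, hψ, Fᶜ, rfl⟩
  union_mem := by
    rintro _ _ ⟨ψ, hψ, F, rfl⟩ ⟨ψ', hψ', F', rfl⟩
    refine ⟨fun i x => Nat.pair (ψ i x) (ψ' i x), fun i => ?_,
      {w | (fun i => (w i).unpair.1) ∈ F ∨ (fun i => (w i).unpair.2) ∈ F'}, ?_⟩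
    · exact (measurable_of_countable Nat.pairEquiv).comp ((hψ i).prodMk (hψ' i))
    · ext v
      simp [Nat.unpair_pair]

theorem generateFrom_discretelyDeterminedSets [Finite ι] :
    MeasurableSpace.pi = MeasurableSpace.generateFrom (discretelyDeterminedSets α) := by
  apply le_antisymm
  · rw [← generateFrom_pi]
    refine MeasurableSpace.generateFrom_mono ?_
    rintro _ ⟨A, hA, rfl⟩
    classical
    refine ⟨fun i x => if x ∈ A i then 1 else 0, fun i => ?_, {w | ∀ i, w i = 1}, ?_⟩
    · exact Measurable.ite (hA i (Set.mem_univ i)) measurable_const measurable_const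
    · ext v
      simp
  · refine MeasurableSpace.generateFrom_le ?_
    rintro _ ⟨ψ, hψ, F, rfl⟩
    exact (measurable_pi_lambda _ fun i => (hψ i).comp (measurable_pi_apply i))
      F.to_countable.measurableSet

theorem smul_pi_le_of_rectangles {ι : Type*} [Fintype ι] {α : ι → Type*}
    [∀ i, MeasurableSpace (α i)] {P : ∀ i, Measure (α i)} [∀ i, IsFiniteMeasure (P i)]
    {ρ : Measure (∀ i, α i)} [IsFiniteMeasure ρ] (c : ℝ≥0)
    (h : ∀ A : ∀ i, Set (α i), (∀ i, MeasurableSet (A i)) →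
      c * ∏ i, P i (A i) ≤ ρ (Set.univ.pi A)) :
    c • Measure.pi P ≤ ρ := by
  refine measure_le_of_isSetAlgebra (isSetAlgebra_discretelyDeterminedSets α)
    generateFrom_discretelyDeterminedSets ?_
  rintro _ ⟨ψ, hψ, F, rfl⟩
  let Ψ : (∀ i, α i) → ι → ℕ := fun v i => ψ i (v i)
  have hcell : ∀ w, Ψ ⁻¹' {w} = Set.univ.pi fun i => ψ i ⁻¹' {w i} := fun w => by
    ext v
    simp [Ψ, funext_iff]
  have hmeas : ∀ w ∈ F, MeasurableSet (Ψ ⁻¹' {w}) := fun w _ => by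
    rw [hcell]
    exact .univ_pi fun i => hψ i trivial
  change (c • Measure.pi P) (Ψ ⁻¹' F) ≤ ρ (Ψ ⁻¹' F)
  rw [← tsum_measure_preimage_singleton F.to_countable hmeas,
    ← tsum_measure_preimage_singleton F.to_countable hmeas]
  refine ENNReal.tsum_le_tsum fun w => ?_
  rw [hcell, Measure.smul_apply, Measure.pi_pi, ENNReal.smul_def, smul_eq_mul]
  exact h _ fun i => hψ i trivial

theorem lintegral_prod_pi {ι : Type*} [Fintype ι] {α : ι → Type*} [∀ i, MeasurableSpace (α i)]
    {P : ∀ i, Measure (α i)} [∀ i, IsProbabilityMeasure (P i)] {f : ∀ i, α i → ℝ≥0∞}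
    (hf : ∀ i, Measurable (f i)) :
    ∫⁻ v, ∏ i, f i (v i) ∂Measure.pi P = ∏ i, ∫⁻ x, f i x ∂P i := by
  refine (ProbabilityTheory.lintegral_prod_eq_prod_lintegral_of_indepFun Finset.univ
    (fun i (v : ∀ i, α i) => f i (v i))
    (ProbabilityTheory.iIndepFun_pi fun i => (hf i).aemeasurable)
    fun i => (hf i).comp (measurable_pi_apply i)).trans ?_
  exact Finset.prod_congr rfl fun i _ => (measurePreserving_eval P i).lintegral_comp (hf i)

theorem pi_withDensity {ι : Type*} [Fintype ι] {α : ι → Type*} [∀ i, MeasurableSpace (α i)]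
    {P : ∀ i, Measure (α i)} [∀ i, IsProbabilityMeasure (P i)] {f : ∀ i, α i → ℝ≥0∞}
    (hf : ∀ i, Measurable (f i)) [∀ i, SigmaFinite ((P i).withDensity (f i))] :
    Measure.pi (fun i => (P i).withDensity (f i)) =
      (Measure.pi P).withDensity fun v => ∏ i, f i (v i) := by
  refine Measure.pi_eq fun A hA => ?_
  have hprod : ∀ v, (Set.univ.pi A).indicator (fun v => ∏ i, f i (v i)) v =
      ∏ i, (A i).indicator (f i) (v i) := fun v => by
    classical
    simp only [Set.indicator_apply, Set.mem_univ_pi]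
    split_ifs with h
    · exact Finset.prod_congr rfl fun i _ => by rw [if_pos (h i)]
    · obtain ⟨i, hi⟩ := not_forall.1 h
      exact (Finset.prod_eq_zero (Finset.mem_univ i) (if_neg hi)).symm
  rw [withDensity_apply _ (.univ_pi hA), ← lintegral_indicator (.univ_pi hA),
    lintegral_congr hprod, lintegral_prod_pi fun i => (hf i).indicator (hA i)]
  exact Finset.prod_congr rfl fun i _ => by
    rw [withDensity_apply _ (hA i), lintegral_indicator (hA i)]

theorem ofReal_mul_measure_le_of_le_condExp {Ω : Type*} {m m₀ : MeasurableSpace Ω} (hm : m ≤ m₀)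
    (P : Measure Ω) [IsProbabilityMeasure P] {E B : Set Ω} (hE : MeasurableSet E)
    (hB : MeasurableSet[m] B) {a : ℝ}
    (h : ∀ᵐ ω ∂P, a ≤ condExp m P (E.indicator fun _ => (1 : ℝ)) ω) :
    ENNReal.ofReal a * P B ≤ P (E ∩ B) := by
  have hint : Integrable (E.indicator fun _ => (1 : ℝ)) P := (integrable_const 1).indicator hE
  have hreal : P.real B * a ≤ P.real (E ∩ B) := by
    calc P.real B * a = ∫ _ in B, a ∂P := by rw [setIntegral_const, smul_eq_mul]
      _ ≤ ∫ ω in B, condExp m P (E.indicator fun _ => (1 : ℝ)) ω ∂P :=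
          integral_mono_ae (integrable_const _) integrable_condExp.integrableOn
            (ae_restrict_of_ae h)
      _ = P.real (E ∩ B) := by
          rw [setIntegral_condExp hm hint hB, integral_indicator hE, setIntegral_const,
            smul_eq_mul, mul_one, measureReal_restrict_apply hE]
  rw [← ofReal_measureReal (s := B), ← ofReal_measureReal (s := E ∩ B),
    ← ENNReal.ofReal_mul' measureReal_nonneg, mul_comm]
  exact ENNReal.ofReal_le_ofReal hreal

theorem exists_lt_setLIntegral_of_lt_lintegral {Ω : Type*} [MeasurableSpace Ω] {P : Measure Ω}
    [SigmaFinite P] {f : Ω → ℝ≥0} {L : ℝ≥0∞} (h : L < ∫⁻ x, f x ∂P) :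
    ∃ δ > 0, ∀ U, MeasurableSet U → P Uᶜ < δ → L < ∫⁻ x in U, f x ∂P := by
  obtain ⟨g, hgf, hg_top, hL⟩ := exists_lt_lintegral_simpleFunc_of_lt_lintegral h
  obtain ⟨δ, hδ, hsmall⟩ := exists_pos_setLIntegral_lt_of_measure_lt hg_top.ne
    (tsub_pos_of_lt hL).ne'
  refine ⟨δ, hδ, fun U hU hPU => lt_of_lt_of_le ?_
    (lintegral_mono fun x => ENNReal.coe_le_coe.2 (hgf x) : ∫⁻ x in U, (g x : ℝ≥0∞) ∂P ≤ _)⟩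
  by_contra! hle
  refine lt_irrefl (∫⁻ x, (g x : ℝ≥0∞) ∂P) ?_
  calc ∫⁻ x, (g x : ℝ≥0∞) ∂P = ∫⁻ x in U, (g x : ℝ≥0∞) ∂P + ∫⁻ x in Uᶜ, (g x : ℝ≥0∞) ∂P :=
        (lintegral_add_compl _ hU).symm
    _ < L + (∫⁻ x, (g x : ℝ≥0∞) ∂P - L) := ENNReal.add_lt_add_of_le_of_lt
        (ne_top_of_le_ne_top hL.ne_top hle) hle (hsmall _ hPU)
    _ = ∫⁻ x, (g x : ℝ≥0∞) ∂P := add_tsub_cancel_of_le hL.le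

theorem ofReal_exp_le_iff_le_log_div {c : ℝ≥0∞} {N : ℕ} (hN : 0 < N) {b : ℝ} :
    ENNReal.ofReal (Real.exp (N * b)) ≤ c ↔ (b : EReal) ≤ ENNReal.log c / (N : EReal) := by
  have hN' : (0 : EReal) < (N : EReal) := by exact_mod_cast hN
  rw [EReal.le_div_iff_mul_le hN' (EReal.natCast_ne_top N), ← ENNReal.log_le_log_iff,
    ENNReal.log_ofReal_of_pos (Real.exp_pos _), Real.log_exp, mul_comm]
  norm_cast

theorem ofReal_exp_lt_iff_lt_log_div {c : ℝ≥0∞} {N : ℕ} (hN : 0 < N) {b : ℝ} :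
    ENNReal.ofReal (Real.exp (N * b)) < c ↔ (b : EReal) < ENNReal.log c / (N : EReal) := by
  have hN' : (0 : EReal) < (N : EReal) := by exact_mod_cast hN
  rw [EReal.lt_div_iff hN' (EReal.natCast_ne_top N), ← ENNReal.log_lt_log_iff,
    ENNReal.log_ofReal_of_pos (Real.exp_pos _), Real.log_exp, mul_comm]
  norm_cast

end Measure

section WeakLaw

variable {α : Type*} [MeasurableSpace α]

theorem measurableSet_frequencies {ι : Type*} (s : Finset ι) {A : ι → Set α}
    (hA : ∀ i, MeasurableSet (A i)) {T : ℕ} (c : ι → ℝ) (κ : ℝ) :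
    MeasurableSet {v : Fin T → α | ∀ i ∈ s, |∑ j, (A i).indicator 1 (v j) - c i| ≤ κ} := by
  have hcount : ∀ i, Measurable fun v : Fin T → α => ∑ j, (A i).indicator (1 : α → ℝ) (v j) :=
    fun i => Finset.measurable_sum _ fun j _ =>
      (measurable_one.indicator (hA i)).comp (measurable_pi_apply j)
  simp only [Set.ofPred_forall]
  exact .biInter s.countable_toSet fun i _ =>
    measurableSet_le ((hcount i).sub_const _).abs measurable_const

variable {Q : Measure α} [IsProbabilityMeasure Q]

theorem measure_pi_le_abs_sum_sub_le {f : α → ℝ} (hf : MemLp f 2 Q) {κ : ℝ} (hκ : 0 < κ) {T : ℕ}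
    (hT : 0 < T) :
    Measure.pi (fun _ : Fin T => Q) {v | T * κ ≤ |∑ j, f (v j) - T * ∫ x, f x ∂Q|} ≤
      ENNReal.ofReal (ProbabilityTheory.variance f Q / κ ^ 2 / T) := by
  have hmem : ∀ j : Fin T, MemLp (fun v : Fin T → α => f (v j)) 2 (Measure.pi fun _ => Q) :=
    fun j => hf.comp_measurePreserving (measurePreserving_eval (fun _ : Fin T => Q) j)
  have hmean : ∫ v, ∑ j, f (v j) ∂Measure.pi (fun _ : Fin T => Q) = T * ∫ x, f x ∂Q := by
    rw [integral_finsetSum _ fun j _ => (hmem j).integrable one_le_two]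
    simp only [integral_comp_eval (μ := fun _ : Fin T => Q) hf.aestronglyMeasurable,
      Finset.sum_const, Finset.card_univ, Fintype.card_fin, nsmul_eq_mul]
  have hvar : ProbabilityTheory.variance (fun v : Fin T → α => ∑ j, f (v j))
      (Measure.pi fun _ => Q) = T * ProbabilityTheory.variance f Q := by
    simpa [Finset.sum_fn] using
      ProbabilityTheory.variance_sum_pi (μ := fun _ : Fin T => Q) (X := fun _ => f) fun _ => hf
  have hT' : (0 : ℝ) < T := by exact_mod_cast hT
  have hcheb := ProbabilityTheory.meas_ge_le_variance_div_sq (memLp_finsetSum Finset.univ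
    fun j _ => hmem j) (mul_pos hT' hκ)
  rw [hmean, hvar] at hcheb
  refine hcheb.trans_eq (congrArg ENNReal.ofReal ?_)
  field_simp

theorem tendsto_measure_pi_le_abs_sum_sub {f : α → ℝ} (hf : MemLp f 2 Q) {κ : ℝ} (hκ : 0 < κ) :
    Tendsto (fun T : ℕ => Measure.pi (fun _ : Fin T => Q)
      {v | T * κ ≤ |∑ j, f (v j) - T * ∫ x, f x ∂Q|}) atTop (𝓝 0) := by
  refine tendsto_of_tendsto_of_tendsto_of_le_of_le' tendsto_const_nhds ?_
    (Eventually.of_forall fun _ => zero_le)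
    ((eventually_gt_atTop 0).mono fun T hT => measure_pi_le_abs_sum_sub_le hf hκ hT)
  simpa using ENNReal.tendsto_ofReal (tendsto_const_div_atTop_nhds_zero_nat
    (ProbabilityTheory.variance f Q / κ ^ 2))

theorem eventually_half_le_measure_pi_frequencies {ι : Type*} (s : Finset ι) {A : ι → Set α}
    (hA : ∀ i, MeasurableSet (A i)) {κ : ℝ} (hκ : 0 < κ) :
    ∀ᶠ T : ℕ in atTop, 1 / 2 ≤ Measure.pi (fun _ : Fin T => Q)
      {v | ∀ i ∈ s, |∑ j, (A i).indicator 1 (v j) - T * Q.real (A i)| ≤ T * κ} := by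
  have htendsto := tendsto_finsetSum s fun i _ => tendsto_measure_pi_le_abs_sum_sub (Q := Q)
    (f := (A i).indicator 1) (memLp_indicator_const 2 (hA i) 1 (.inr (measure_ne_top _ _))) hκ
  simp only [integral_indicator_one (hA _), Finset.sum_const_zero] at htendsto
  filter_upwards [htendsto.eventually_le_const (show (0 : ℝ≥0∞) < 1 / 2 by simp)] with T hT
  set B := {v : Fin T → α |
    ∀ i ∈ s, |∑ j, (A i).indicator 1 (v j) - T * Q.real (A i)| ≤ T * κ} with hB
  have hBc : Measure.pi (fun _ : Fin T => Q) Bᶜ ≤ 1 / 2 := by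
    refine (measure_mono fun v hv => ?_).trans ((measure_biUnion_finset_le s _).trans hT)
    simp only [hB, Set.mem_compl_iff, Set.mem_ofPred_eq, not_forall, not_le] at hv
    obtain ⟨i, hi, hlt⟩ := hv
    exact Set.mem_biUnion hi hlt.le
  rw [← compl_compl B, prob_compl_eq_one_sub (measurableSet_frequencies s hA _ _).compl]
  refine ENNReal.le_sub_of_add_le_left (measure_ne_top _ _) ?_
  calc _ ≤ (1 / 2 + 1 / 2 : ℝ≥0∞) := by gcongr
    _ = 1 := ENNReal.add_halves 1

end WeakLaw

section SumsNear

theorem seminorm_sum_le {X ι : Type*} [AddCommGroup X] [Module ℝ X] (p : Seminorm ℝ X)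
    (s : Finset ι) (f : ι → X) : p (∑ i ∈ s, f i) ≤ ∑ i ∈ s, p (f i) :=
  Finset.le_sum_of_subadditive p (map_zero p).le (map_add_le_add p) s f

variable {X : Type*} [AddCommGroup X] [Module ℝ X] [MeasurableSpace X] {p : Seminorm ℝ X}
  {P : Measure X}

/-- Lower large deviation bound for sums of independent variables of law `P`: for `T` large, with
probability at least `exp (T κ)`, the sum of `T` such variables is within `T r` of `T y`. To avoid
any measurability requirement on sums, this is stated by means of measurable sets of samples. -/
def SumsNear (p : Seminorm ℝ X) (P : Measure X) (y : X) (r κ : ℝ) : Prop :=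
  ∀ᶠ T : ℕ in atTop, ∃ B : Set (Fin T → X), MeasurableSet B ∧
    (∀ v ∈ B, p (∑ j, v j - (T : ℝ) • y) ≤ T * r) ∧
    ENNReal.ofReal (Real.exp (T * κ)) ≤ Measure.pi (fun _ => P) B

theorem exists_simpleFunc_seminorm_sub_lt_one (hmeas : ∀ y, MeasurableSet (p.ball y 1))
    (S : Finset X) : ∃ φ : SimpleFunc X X, ∀ x ∈ ⋃ y ∈ S, p.ball y 1, p (x - φ x) < 1 := by
  classical
  induction S using Finset.induction_on with
  | empty => exact ⟨SimpleFunc.const X 0, by simp⟩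
  | insert z S _ ih =>
    obtain ⟨φ, hφ⟩ := ih
    refine ⟨SimpleFunc.piecewise (p.ball z 1) (hmeas z) (SimpleFunc.const X z) φ, fun x hx => ?_⟩
    rw [SimpleFunc.coe_piecewise]
    by_cases hz : x ∈ p.ball z 1
    · rwa [Set.piecewise_eq_of_mem _ _ _ hz]
    · rw [Set.piecewise_eq_of_notMem _ _ _ hz]
      rw [Finset.set_biUnion_insert] at hx
      exact hφ x (hx.resolve_left hz)

theorem seminorm_sum_simpleFunc_sub_le (φ : SimpleFunc X X) {T : ℕ} (v : Fin T → X) {c : X → ℝ}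
    {κ : ℝ} (h : ∀ y ∈ φ.range, |∑ j, (φ ⁻¹' {y}).indicator 1 (v j) - c y| ≤ κ) :
    p (∑ j, φ (v j) - ∑ y ∈ φ.range, c y • y) ≤ κ * ∑ y ∈ φ.range, p y := by
  have hsum : ∑ j, φ (v j) =
      ∑ y ∈ φ.range, (∑ j, (φ ⁻¹' {y}).indicator (1 : X → ℝ) (v j)) • y := by
    classical
    simp only [Finset.sum_smul]
    rw [Finset.sum_comm]
    refine Finset.sum_congr rfl fun j _ => ?_
    simp [Set.indicator_apply, ite_smul]
  rw [hsum, ← Finset.sum_sub_distrib, Finset.mul_sum]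
  simp only [← sub_smul]
  refine (seminorm_sum_le p _ _).trans (Finset.sum_le_sum fun y hy => ?_)
  rw [map_smul_eq_mul, Real.norm_eq_abs]
  gcongr
  exact h y hy

theorem seminorm_sum_sub_smul_le_of_simpleFunc (φ : SimpleFunc X X) {T : ℕ} {v : Fin T → X}
    (hv : ∀ j, p (v j - φ (v j)) ≤ 1) {c : X → ℝ} {κ : ℝ} (hκ : κ * ∑ y ∈ φ.range, p y ≤ 1)
    (h : ∀ y ∈ φ.range, |∑ j, (φ ⁻¹' {y}).indicator 1 (v j) - T * c y| ≤ T * κ) :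
    p (∑ j, v j - (T : ℝ) • ∑ y ∈ φ.range, c y • y) ≤ T * 2 := by
  have hφ := seminorm_sum_simpleFunc_sub_le (p := p) φ v h
  simp only [mul_smul, ← Finset.smul_sum] at hφ
  calc p (∑ j, v j - (T : ℝ) • ∑ y ∈ φ.range, c y • y)
      = p (∑ j, (v j - φ (v j)) + (∑ j, φ (v j) - (T : ℝ) • ∑ y ∈ φ.range, c y • y)) := by
        rw [Finset.sum_sub_distrib, sub_add_sub_cancel]
    _ ≤ ∑ j, p (v j - φ (v j)) + T * κ * ∑ y ∈ φ.range, p y :=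
        (map_add_le_add p _ _).trans (add_le_add (seminorm_sum_le p _ _) hφ)
    _ ≤ ∑ _j : Fin T, 1 + T * 1 := by
        rw [mul_assoc]
        gcongr with j
        exact hv j
    _ = T * 2 := by
        rw [Finset.sum_const, Finset.card_univ, Fintype.card_fin, nsmul_eq_mul]
        ring

theorem exists_sumsNear_neg_of_measure_eq_one [IsProbabilityMeasure P]
    (hmeas : ∀ y, MeasurableSet (p.ball y 1)) {S : Finset X}
    (hS : P (⋃ y ∈ S, p.ball y 1)ᶜ = 0) : ∃ y, ∀ ε > 0, SumsNear p P y 2 (-ε) := by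
  obtain ⟨φ, hφ⟩ := exists_simpleFunc_seminorm_sub_lt_one hmeas S
  refine ⟨∑ y ∈ φ.range, P.real (φ ⁻¹' {y}) • y, fun ε hε => ?_⟩
  have hpos : 0 < 1 + ∑ y ∈ φ.range, p y :=
    add_pos_of_pos_of_nonneg one_pos (Finset.sum_nonneg fun y _ => apply_nonneg p y)
  set κ : ℝ := (1 + ∑ y ∈ φ.range, p y)⁻¹
  have hκ : 0 < κ := inv_pos.2 hpos
  have hκp : κ * ∑ y ∈ φ.range, p y ≤ 1 := by
    rw [inv_mul_le_one₀ hpos]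
    linarith
  have hhalf : ∀ᶠ T : ℕ in atTop, ENNReal.ofReal (Real.exp (T * -ε)) ≤ 1 / 2 := by
    have hlim : Tendsto (fun T : ℕ => ENNReal.ofReal (Real.exp (T * -ε))) atTop (𝓝 0) := by
      simpa using ENNReal.tendsto_ofReal (Real.tendsto_exp_atBot.comp
        (tendsto_natCast_atTop_atTop.atTop_mul_const_of_neg (neg_lt_zero.2 hε)))
    exact hlim.eventually_le_const (by simp)
  have hU : MeasurableSet (⋃ y ∈ S, p.ball y 1) :=
    .biUnion S.countable_toSet fun y _ => hmeas y
  filter_upwards [hhalf, eventually_half_le_measure_pi_frequencies (Q := P) φ.range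
    (fun y => φ.measurableSet_fiber y) hκ] with T hT hfreq
  have hconull : Measure.pi (fun _ : Fin T => P)
      (Set.univ.pi fun _ => ⋃ y ∈ S, p.ball y 1)ᶜ = 0 := by
    rw [prob_compl_eq_zero_iff (.univ_pi fun _ => hU), Measure.pi_pi]
    simp [(prob_compl_eq_zero_iff hU).1 hS]
  rw [← measure_inter_conull hconull] at hfreq
  refine ⟨_, (measurableSet_frequencies φ.range (fun y => φ.measurableSet_fiber y) _ _).inter
    (.univ_pi fun _ => hU), fun v hv => ?_, hT.trans hfreq⟩
  exact seminorm_sum_sub_smul_le_of_simpleFunc φ (fun j => (hφ _ (hv.2 j (Set.mem_univ j))).le)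
    hκp hv.1

theorem SumsNear.of_withDensity [IsProbabilityMeasure P] {f : X → ℝ≥0∞} (hf : Measurable f)
    [SigmaFinite (P.withDensity f)] {l : X →ₗ[ℝ] ℝ} {b δ : ℝ}
    (hfl : ∀ x, f x ≤ ENNReal.ofReal (Real.exp (l x + b))) (hδ : 0 ≤ δ) (hl : ∀ x, l x ≤ δ * p x)
    {y : X} {r κ : ℝ} (h : SumsNear p (P.withDensity f) y r κ) :
    SumsNear p P y r (κ - b - l y - δ * r) := by
  filter_upwards [h] with T ⟨B, hB, hBr, hκ⟩
  refine ⟨B, hB, hBr, ?_⟩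
  have hdens : ∀ v ∈ B, ∏ j, f (v j) ≤ ENNReal.ofReal (Real.exp (T * (l y + δ * r + b))) := by
    intro v hv
    have hlv : ∑ j, l (v j) ≤ T * (l y + δ * r) := by
      have := (hl _).trans (mul_le_mul_of_nonneg_left (hBr v hv) hδ)
      rw [map_sub, map_sum, map_smul, smul_eq_mul] at this
      linarith
    calc ∏ j, f (v j) ≤ ∏ j, ENNReal.ofReal (Real.exp (l (v j) + b)) :=
          Finset.prod_le_prod' fun j _ => hfl (v j)
      _ = ENNReal.ofReal (Real.exp (∑ j, l (v j) + T * b)) := by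
          rw [← ENNReal.ofReal_prod_of_nonneg fun _ _ => (Real.exp_pos _).le, ← Real.exp_sum]
          simp [Finset.sum_add_distrib]
      _ ≤ _ := by
          gcongr
          linarith
  have hle : ENNReal.ofReal (Real.exp (T * κ)) ≤
      ENNReal.ofReal (Real.exp (T * (l y + δ * r + b))) * Measure.pi (fun _ => P) B := by
    rw [pi_withDensity fun _ => hf, withDensity_apply _ hB] at hκ
    exact hκ.trans ((setLIntegral_mono' hB hdens).trans_eq (setLIntegral_const _ _))
  rw [show (T : ℝ) * (κ - b - l y - δ * r) = T * κ - T * (l y + δ * r + b) by ring, Real.exp_sub,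
    ENNReal.ofReal_div_of_pos (Real.exp_pos _)]
  exact ENNReal.div_le_of_le_mul' hle

theorem exists_setLIntegral_exp_eq_ofReal_exp [IsFiniteMeasure P] {l : X →ₗ[ℝ] ℝ}
    {δ : ℝ} (hmeas : ∀ y, MeasurableSet (p.ball y 1)) (hlp : ∀ x, l x ≤ δ * p x) (hδ : 0 ≤ δ)
    (hcover : ∀ ε > 0, ∃ S : Finset X, P (⋃ y ∈ S, p.ball y 1)ᶜ < ε) {κ : ℝ}
    (hκ : ENNReal.ofReal (Real.exp κ) < ∫⁻ x, ENNReal.ofReal (Real.exp (l x)) ∂P) :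
    ∃ S : Finset X, ∃ z > κ,
      ∫⁻ x in ⋃ y ∈ S, p.ball y 1, ENNReal.ofReal (Real.exp (l x)) ∂P =
        ENNReal.ofReal (Real.exp z) := by
  obtain ⟨η, hη, hlt⟩ := exists_lt_setLIntegral_of_lt_lintegral hκ
  obtain ⟨S, hS⟩ := hcover η hη
  have hU : MeasurableSet (⋃ y ∈ S, p.ball y 1) := .biUnion S.countable_toSet fun y _ => hmeas y
  have hbound : ∀ x ∈ ⋃ y ∈ S, p.ball y 1, l x ≤ δ * (1 + ∑ y ∈ S, p y) := by
    intro x hx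
    obtain ⟨y, hy, hxy⟩ := Set.mem_iUnion₂.1 hx
    refine (hlp x).trans (mul_le_mul_of_nonneg_left ?_ hδ)
    calc p x = p ((x - y) + y) := by rw [sub_add_cancel]
      _ ≤ p (x - y) + p y := map_add_le_add p _ _
      _ ≤ 1 + ∑ y ∈ S, p y := add_le_add (p.mem_ball.1 hxy).le
          (Finset.single_le_sum (f := p) (fun y _ => apply_nonneg p y) hy)
  have hlow := hlt _ hU hS
  set Z := ∫⁻ x in ⋃ y ∈ S, p.ball y 1, ENNReal.ofReal (Real.exp (l x)) ∂P
  have hZ : Z ≠ ⊤ := by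
    refine ((setLIntegral_mono' hU fun x hx => ENNReal.ofReal_le_ofReal
      (Real.exp_le_exp.2 (hbound x hx))).trans_lt ?_).ne
    rw [setLIntegral_const]
    exact ENNReal.mul_lt_top ENNReal.ofReal_lt_top (measure_lt_top _ _)
  have hZpos : 0 < Z.toReal := ENNReal.toReal_pos (hlow.trans_le' zero_le).ne' hZ
  refine ⟨S, Real.log Z.toReal, ?_, by rw [Real.exp_log hZpos, ENNReal.ofReal_toReal hZ]⟩
  exact (Real.lt_log_iff_exp_lt hZpos).2
    ((ENNReal.ofReal_lt_iff_lt_toReal (Real.exp_pos _).le hZ).1 hlow)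

theorem exists_sumsNear_of_lt_lintegral_exp [IsProbabilityMeasure P]
    (hmeas : ∀ y, MeasurableSet (p.ball y 1))
    (hcover : ∀ ε > 0, ∃ S : Finset X, P (⋃ y ∈ S, p.ball y 1)ᶜ < ε) {l : X →ₗ[ℝ] ℝ}
    (hl : Measurable l) {δ : ℝ} (hδ : 0 ≤ δ) (hlp : ∀ x, l x ≤ δ * p x) {κ : ℝ}
    (hκ : ENNReal.ofReal (Real.exp κ) < ∫⁻ x, ENNReal.ofReal (Real.exp (l x)) ∂P) :
    ∃ y, SumsNear p P y 2 (κ - l y - 2 * δ) := by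
  obtain ⟨S, z, hz, hZ⟩ := exists_setLIntegral_exp_eq_ofReal_exp hmeas hlp hδ hcover hκ
  set U := ⋃ y ∈ S, p.ball y 1
  have hU : MeasurableSet U := .biUnion S.countable_toSet fun y _ => hmeas y
  let f : X → ℝ≥0∞ := U.indicator fun x => ENNReal.ofReal (Real.exp (l x + -z))
  have hf : Measurable f := (hl.add_const _).exp.ennreal_ofReal.indicator hU
  have hfU : ∫⁻ x in U, ENNReal.ofReal (Real.exp (l x + -z)) ∂P = 1 := by
    simp only [Real.exp_add, ENNReal.ofReal_mul (Real.exp_pos _).le]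
    rw [lintegral_mul_const _ hl.exp.ennreal_ofReal, hZ, ← ENNReal.ofReal_mul (Real.exp_pos _).le,
      ← Real.exp_add, add_neg_cancel, Real.exp_zero, ENNReal.ofReal_one]
  have hprob : IsProbabilityMeasure (P.withDensity f) := ⟨by
    rw [withDensity_apply _ .univ, Measure.restrict_univ, lintegral_indicator hU, hfU]⟩
  have hSU : P.withDensity f Uᶜ = 0 := by
    rw [withDensity_apply _ hU.compl, ← lintegral_indicator hU.compl]
    simp [f, Set.indicator_indicator]
  obtain ⟨y, hy⟩ := exists_sumsNear_neg_of_measure_eq_one hmeas hSU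
  refine ⟨y, ?_⟩
  convert! (hy (z - κ) (sub_pos.2 hz)).of_withDensity hf (b := -z) (fun x =>
    Set.indicator_le_self U _ x) hδ hlp using 1
  ring

theorem SumsNear.of_seminorm_le {y : X} {r κ : ℝ} (h : SumsNear p P y r κ) {q : Seminorm ℝ X}
    {c : ℝ} (hc : 0 ≤ c) (hqp : ∀ x, q x ≤ c * p x) : SumsNear q P y (c * r) κ := by
  filter_upwards [h] with T ⟨B, hB, hBr, hκ⟩
  refine ⟨B, hB, fun v hv => ?_, hκ⟩
  calc q (∑ j, v j - (T : ℝ) • y) ≤ c * p (∑ j, v j - (T : ℝ) • y) := hqp _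
    _ ≤ c * (T * r) := mul_le_mul_of_nonneg_left (hBr v hv) hc
    _ = T * (c * r) := by ring

theorem sum_ite_val_lt_sub_smul {E : Type*} [AddCommGroup E] [Module ℝ E] {T k : ℕ} (hk : k ≤ T)
    (u : ℝ) (a b : E) :
    ∑ j : Fin T, (if (j : ℕ) < k then a else b) - (T : ℝ) • (u • a + (1 - u) • b) =
      (k - u * T) • (a - b) := by
  have hsplit : ∀ j : Fin T, (if (j : ℕ) < k then a else b) =
      b + if (j : ℕ) < k then a - b else 0 :=
    fun j => by split_ifs <;> abel
  simp only [hsplit, Finset.sum_add_distrib, ← Finset.sum_filter, Finset.sum_const,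
    Fin.card_filter_val_lt, min_eq_right hk, Finset.card_univ, Fintype.card_fin,
    ← Nat.cast_smul_eq_nsmul ℝ]
  module

theorem sumsNear_of_le_measure_ball [IsFiniteMeasure P] {η : ℝ} {y₁ y₂ : X} {κ₁ κ₂ u v : ℝ}
    (hmeas : ∀ y, MeasurableSet (p.ball y η)) (hu : 0 ≤ u) (hv : 0 ≤ v) (huv : u + v = 1)
    (h₁ : ENNReal.ofReal (Real.exp κ₁) ≤ P (p.ball y₁ η))
    (h₂ : ENNReal.ofReal (Real.exp κ₂) ≤ P (p.ball y₂ η)) {δ ε : ℝ} (hδ : 0 < δ) (hε : 0 < ε) :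
    SumsNear p P (u • y₁ + v • y₂) (η + δ) (u * κ₁ + v * κ₂ - ε) := by
  obtain rfl : v = 1 - u := by linarith
  filter_upwards [tendsto_natCast_atTop_atTop.eventually_ge_atTop (p (y₁ - y₂) / δ),
    tendsto_natCast_atTop_atTop.eventually_ge_atTop (|κ₁ - κ₂| / ε)] with T hTδ hTε
  rw [div_le_iff₀ hδ] at hTδ
  rw [div_le_iff₀ hε] at hTε
  set k := ⌊u * T⌋₊
  have huT : 0 ≤ u * T := by positivity
  have hkT : k ≤ T := Nat.floor_le_of_le (mul_le_of_le_one_left (by positivity) (by linarith))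
  have hku : |k - u * T| ≤ 1 := abs_le.2 ⟨by linarith [Nat.lt_floor_add_one (u * T)],
    by linarith [Nat.floor_le huT]⟩
  let c : Fin T → X := fun j => if (j : ℕ) < k then y₁ else y₂
  refine ⟨Set.univ.pi fun j => p.ball (c j) η, .univ_pi fun j => hmeas _, fun w hw => ?_, ?_⟩
  · have hc : ∑ j, c j - (T : ℝ) • (u • y₁ + (1 - u) • y₂) = (k - u * T) • (y₁ - y₂) :=
      sum_ite_val_lt_sub_smul hkT u y₁ y₂
    calc _ = p (∑ j, (w j - c j) + (k - u * T) • (y₁ - y₂)) := by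
          rw [← hc, Finset.sum_sub_distrib, sub_add_sub_cancel]
      _ ≤ ∑ j, p (w j - c j) + |k - u * T| * p (y₁ - y₂) := by
          refine (map_add_le_add p _ _).trans (add_le_add (seminorm_sum_le p _ _) ?_)
          rw [map_smul_eq_mul, Real.norm_eq_abs]
      _ ≤ ∑ _j : Fin T, η + 1 * p (y₁ - y₂) := by
          gcongr with j
          exact (p.mem_ball.1 (hw j (Set.mem_univ j))).le
      _ ≤ T * (η + δ) := by
          rw [Finset.sum_const, Finset.card_univ, Fintype.card_fin, nsmul_eq_mul]
          linarith
  · have hκ := sum_ite_val_lt_sub_smul hkT u κ₁ κ₂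
    simp only [smul_eq_mul] at hκ
    have hgap : -|κ₁ - κ₂| ≤ (k - u * T) * (κ₁ - κ₂) := by
      refine (neg_le_neg ?_).trans (neg_abs_le _)
      rw [abs_mul]
      exact mul_le_of_le_one_left (abs_nonneg _) hku
    calc ENNReal.ofReal (Real.exp (T * (u * κ₁ + (1 - u) * κ₂ - ε)))
        ≤ ENNReal.ofReal (Real.exp (∑ j : Fin T, if (j : ℕ) < k then κ₁ else κ₂)) := by
          gcongr
          linarith
      _ = ∏ j : Fin T, ENNReal.ofReal (Real.exp (if (j : ℕ) < k then κ₁ else κ₂)) := by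
          rw [Real.exp_sum, ENNReal.ofReal_prod_of_nonneg fun _ _ => (Real.exp_pos _).le]
      _ ≤ ∏ j, P (p.ball (c j) η) := by
          refine Finset.prod_le_prod' fun j _ => ?_
          simp only [c]
          split_ifs
          exacts [h₁, h₂]
      _ = Measure.pi (fun _ => P) (Set.univ.pi fun j => p.ball (c j) η) := (Measure.pi_pi _ _).symm

end SumsNear

namespace LatticeBox

variable {d : ℕ}

theorem mem_sites {Λ : LatticeBox d} {w : Fin d → ℤ} :
    w ∈ Λ.sites ↔ ∀ i, Λ.corner i ≤ w i ∧ w i < Λ.corner i + Λ.side := by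
  simp [sites]

theorem mem_sites_translate {Λ : LatticeBox d} {z w : Fin d → ℤ} :
    w ∈ (Λ.translate z).sites ↔ w - z ∈ Λ.sites := by
  simp only [mem_sites, translate, Pi.add_apply, Pi.sub_apply]
  refine forall_congr' fun i => ?_
  constructor <;> rintro ⟨h1, h2⟩ <;> constructor <;> linarith

theorem card_sites (Λ : LatticeBox d) : Λ.sites.card = (Λ.side : ℕ) ^ d := by
  simp [sites]

theorem card_sites_pos (Λ : LatticeBox d) : 0 < Λ.sites.card := by
  rw [card_sites]
  positivity

theorem sites_translate (Λ : LatticeBox d) (z : Fin d → ℤ) :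
    (Λ.translate z).sites = Λ.sites.map (addRightEmbedding z) := by
  ext w
  simp only [mem_sites_translate, Finset.mem_map, addRightEmbedding_apply]
  exact ⟨fun h => ⟨w - z, h, sub_add_cancel w z⟩, by rintro ⟨v, h, rfl⟩; simpa using h⟩

theorem map_subset_sites_translate {Λ : LatticeBox d} {S : Finset (Fin d → ℤ)}
    (h : S ⊆ Λ.sites) (z : Fin d → ℤ) :
    S.map (addRightEmbedding z) ⊆ (Λ.translate z).sites := by
  rw [sites_translate]
  exact Finset.map_subset_map.2 h

theorem sites_one (z : Fin d → ℤ) : (⟨z, 1⟩ : LatticeBox d).sites = {z} := by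
  ext w
  simp only [mem_sites, Finset.mem_singleton, funext_iff]
  refine forall_congr' fun i => ?_
  simp only [PNat.one_coe, Nat.cast_one]
  omega

end LatticeBox

section Shift

open LatticeBox

variable {X : Type*} {d : ℕ}

theorem shiftSet_eq_preimage (z : Fin d → ℤ) (A : Set (Config d X)) :
    shiftSet z A = (fun (σ : Config d X) (w : Fin d → ℤ) => σ (w + z)) ⁻¹' A := by
  ext σ
  exact ⟨by rintro ⟨τ, hτ, rfl⟩; simpa using hτ, fun h => ⟨_, h, by simp⟩⟩

theorem shiftSet_inter (z : Fin d → ℤ) (A B : Set (Config d X)) :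
    shiftSet z (A ∩ B) = shiftSet z A ∩ shiftSet z B := by
  simp only [shiftSet_eq_preimage, Set.preimage_inter]

theorem shiftSet_neg_setOf_apply_mem (z : Fin d → ℤ) (A : Set X) :
    shiftSet (-z) {σ : Config d X | σ z ∈ A} = {σ | σ 0 ∈ A} := by
  ext σ
  simp [shiftSet_eq_preimage]

variable [AddCommGroup X] [Module ℝ X]

theorem empMean_translate (Λ : LatticeBox d) (z : Fin d → ℤ) (σ : Config d X) :
    empMean (Λ.translate z) σ = empMean Λ (fun w => σ (w + z)) := by
  simp only [empMean, card_sites]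
  rw [sites_translate, Finset.sum_map]
  simp [LatticeBox.translate]

theorem shiftSet_neg_empMean_preimage (Λ : LatticeBox d) (z : Fin d → ℤ) (A : Set X) :
    shiftSet (-z) ((empMean (Λ.translate z) : Config d X → X) ⁻¹' A) = empMean Λ ⁻¹' A := by
  ext σ
  simp [shiftSet_eq_preimage, empMean_translate]

theorem empMean_sites_one (z : Fin d → ℤ) (σ : Config d X) :
    empMean (⟨z, 1⟩ : LatticeBox d) σ = σ z := by
  simp [empMean, sites_one]

theorem card_smul_empMean (Λ : LatticeBox d) (σ : Config d X) :
    (Λ.sites.card : ℝ) • empMean Λ σ = ∑ z ∈ Λ.sites, σ z := by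
  rw [empMean, smul_inv_smul₀]
  exact_mod_cast Λ.card_sites_pos.ne'

end Shift

section FieldSigma

open LatticeBox

variable {X : Type*} [AddCommGroup X] [Module ℝ X] [MeasurableSpace X] {d : ℕ}
  {S T : Finset (Fin d → ℤ)}

theorem measurable_empMean {Λ : LatticeBox d} (h : Λ.sites ⊆ S) :
    @Measurable _ _ (fieldSigma X S) _ (empMean Λ : Config d X → X) := by
  rw [measurable_iff_comap_le]
  exact le_iSup₂_of_le Λ h le_rfl

theorem measurable_eval {z : Fin d → ℤ} (h : z ∈ S) :
    @Measurable _ _ (fieldSigma X S) _ fun σ : Config d X => σ z := by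
  have heq : (fun σ : Config d X => σ z) = empMean ⟨z, 1⟩ :=
    funext fun σ => (empMean_sites_one z σ).symm
  rw [heq]
  exact measurable_empMean ((sites_one z).trans_subset (Finset.singleton_subset_iff.2 h))

theorem fieldSigma_mono (h : S ⊆ T) : fieldSigma X S ≤ fieldSigma X T :=
  iSup₂_le fun Λ hΛ => le_iSup₂_of_le Λ (hΛ.trans h) le_rfl

theorem measurableSet_shiftSet {z : Fin d → ℤ} (h : S.map (addRightEmbedding z) ⊆ T)
    {A : Set (Config d X)} (hA : MeasurableSet[fieldSigma X S] A) :
    MeasurableSet[fieldSigma X T] (shiftSet z A) := by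
  have hshift : @Measurable _ _ (fieldSigma X T) (fieldSigma X S)
      (fun (σ : Config d X) (w : Fin d → ℤ) => σ (w + z)) := by
    rw [measurable_iff_comap_le]
    simp only [MeasurableSpace.comap_iSup, MeasurableSpace.comap_comp]
    refine iSup₂_le fun Λ hΛ => le_iSup₂_of_le (Λ.translate z) ?_ (le_of_eq ?_)
    · rw [sites_translate]
      exact (Finset.map_subset_map.2 hΛ).trans h
    · congr 1
      ext σ
      exact (empMean_translate Λ z σ).symm
  rw [shiftSet_eq_preimage]
  exact hshift hA

end FieldSigma

namespace InvariantSystem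

open LatticeBox

variable {X : Type*} [AddCommGroup X] [Module ℝ X] [MeasurableSpace X] {d : ℕ}
  (μ : InvariantSystem d X)

theorem isProbabilityMeasure_law (Λ : LatticeBox d) :
    @IsProbabilityMeasure _ (fieldSigma X Λ.sites) (μ.law Λ) :=
  @IsProbabilityMeasure.mk _ (fieldSigma X Λ.sites) (μ.law Λ) (μ.law_univ Λ)

theorem cramer_apply_eq_law {n : ℕ+} {Λ : LatticeBox d} (h : (cube d n).sites ⊆ Λ.sites)
    {A : Set X} (hA : MeasurableSet A) :
    μ.cramer n A = μ.law Λ (empMean (cube d n) ⁻¹' A) := by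
  rw [μ.compatible _ _ h _ (measurable_empMean subset_rfl hA)]
  exact @Measure.map_apply _ _ (fieldSigma X _) _ _ _ (measurable_empMean subset_rfl) _ hA

instance isProbabilityMeasure_cramer (n : ℕ+) : IsProbabilityMeasure (μ.cramer n) :=
  ⟨by rw [μ.cramer_apply_eq_law subset_rfl .univ]; exact μ.law_univ _⟩

/-- The decoupling inequality between the cube of side `m` and the sets at distance more than `g`
from it, at the cost of a factor `exp (-c)`. -/
def DecoupledAt (m : ℕ+) (g c : ℝ) : Prop :=
  ∀ (S : Finset (Fin d → ℤ)) (A B : Set (Config d X)),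
    MeasurableSet[fieldSigma X (cube d m).sites] A → MeasurableSet[fieldSigma X S] B →
    (∀ s ∈ S, ∀ z ∈ (cube d m).sites, g < dist s z) →
    ∀ Λ : LatticeBox d, (cube d m).sites ⊆ Λ.sites → S ⊆ Λ.sites →
      ENNReal.ofReal (Real.exp (-c)) * μ.law Λ A * μ.law Λ B ≤ μ.law Λ (A ∩ B)

/-- Whatever the other spins, the conditional probability that a given spin lies in `E` is at
least `a`. By invariance, it is enough to ask this at the origin. -/
def SpinLowerBound (E : Set X) (a : ℝ) : Prop :=
  ∀ Λ : LatticeBox d, (0 : Fin d → ℤ) ∈ Λ.sites → ∀ᵐ σ ∂(μ.law Λ),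
    a ≤ μ.condProb Λ (fieldSigma X (Λ.sites.erase 0)) {η | η 0 ∈ E} σ

variable {μ}

theorem DecoupledAt.translate {m : ℕ+} {g c : ℝ} (h : μ.DecoupledAt m g c) {Λ : LatticeBox d}
    {z : Fin d → ℤ} {S : Finset (Fin d → ℤ)} (hz : ((cube d m).translate z).sites ⊆ Λ.sites)
    (hS : S ⊆ Λ.sites) (hdist : ∀ s ∈ S, ∀ w ∈ ((cube d m).translate z).sites, g < dist s w)
    {A : Set X} (hA : MeasurableSet A) {B : Set (Config d X)}
    (hB : MeasurableSet[fieldSigma X S] B) :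
    ENNReal.ofReal (Real.exp (-c)) * μ.cramer m A * μ.law Λ B ≤
      μ.law Λ (empMean ((cube d m).translate z) ⁻¹' A ∩ B) := by
  have hBΛ := fieldSigma_mono (X := X) hS _ hB
  have hcube : (cube d m).sites ⊆ (Λ.translate (-z)).sites := fun w hw =>
    mem_sites_translate.2 (hz (mem_sites_translate.2 (by simpa using hw)))
  rw [← μ.invariant Λ (-z) _ hBΛ, ← μ.invariant Λ (-z) _ (@MeasurableSet.inter _
    (fieldSigma X _) _ _ (measurable_empMean hz hA) hBΛ), shiftSet_inter,
    shiftSet_neg_empMean_preimage, μ.cramer_apply_eq_law hcube hA]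
  refine h _ _ _ (measurable_empMean subset_rfl hA) (measurableSet_shiftSet subset_rfl hB) ?_ _
    hcube (map_subset_sites_translate hS _)
  intro s' hs' w hw
  obtain ⟨s, hs, rfl⟩ := Finset.mem_map.1 hs'
  have := hdist s hs (w + z) (mem_sites_translate.2 (by simpa using hw))
  rwa [← dist_add_right _ _ z, addRightEmbedding_apply, neg_add_cancel_right]

theorem SpinLowerBound.ofReal_mul_law_le {E : Set X} {a : ℝ} (h : μ.SpinLowerBound E a)
    (hE : MeasurableSet E) {Λ : LatticeBox d} {z : Fin d → ℤ} (hz : z ∈ Λ.sites)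
    {S : Finset (Fin d → ℤ)} (hS : S ⊆ Λ.sites) (hzS : z ∉ S) {B : Set (Config d X)}
    (hB : MeasurableSet[fieldSigma X S] B) :
    ENNReal.ofReal a * μ.law Λ B ≤ μ.law Λ ({σ | σ z ∈ E} ∩ B) := by
  have hBΛ := fieldSigma_mono (X := X) hS _ hB
  have hEz : MeasurableSet[fieldSigma X Λ.sites] {σ : Config d X | σ z ∈ E} :=
    measurable_eval hz hE
  have hzero : (0 : Fin d → ℤ) ∈ (Λ.translate (-z)).sites :=
    mem_sites_translate.2 (by simpa using hz)
  rw [← μ.invariant Λ (-z) _ hBΛ, ← μ.invariant Λ (-z) _ (@MeasurableSet.inter _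
    (fieldSigma X _) _ _ hEz hBΛ), shiftSet_inter,
    shiftSet_neg_setOf_apply_mem]
  refine @ofReal_mul_measure_le_of_le_condExp _ _ (fieldSigma X _)
    (fieldSigma_mono (Finset.erase_subset _ _)) _ (μ.isProbabilityMeasure_law _) _ _
    (measurable_eval hzero hE) (measurableSet_shiftSet (fun w hw => ?_) hB) _ (h _ hzero)
  obtain ⟨s, hs, rfl⟩ := Finset.mem_map.1 hw
  refine Finset.mem_erase.2 ⟨fun h0 => hzS ?_, map_subset_sites_translate hS _ hw⟩
  rw [addRightEmbedding_apply, add_neg_eq_zero] at h0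
  rwa [← h0]

end InvariantSystem

section Tiles

namespace LatticeBox

variable {d : ℕ}

theorem card_sites_cube (d : ℕ) (n : ℕ+) : (cube d n).sites.card = (n : ℕ) ^ d :=
  card_sites _

theorem card_sites_cube_pos (d : ℕ) (n : ℕ+) : (0 : ℝ) < (cube d n).sites.card := by
  exact_mod_cast card_sites_pos _

/-- The number of cubes of side `m` that fit in the cube of side `n` when they are placed
periodically, with period `m + s`. -/
abbrev tileCount (d : ℕ) (m : ℕ+) (s n : ℕ) : ℕ := (n / (m + s)) ^ d

/-- The cubes of side `m` placed with period `m + s` in the cube of side `n`. -/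
def tile (d : ℕ) (m : ℕ+) (s n : ℕ) (j : Fin (tileCount d m s n)) : LatticeBox d :=
  (cube d m).translate fun i => ((m + s : ℕ) : ℤ) * ((finFunctionFinEquiv.symm j i : ℕ) : ℤ)

theorem mem_sites_tile {m : ℕ+} {s n : ℕ} {j : Fin (tileCount d m s n)} {w : Fin d → ℤ} :
    w ∈ (tile d m s n j).sites ↔ ∀ i,
      ((m + s : ℕ) : ℤ) * ((finFunctionFinEquiv.symm j i : ℕ) : ℤ) ≤ w i ∧
        w i < ((m + s : ℕ) : ℤ) * ((finFunctionFinEquiv.symm j i : ℕ) : ℤ) + (m : ℕ) := by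
  simp [tile, mem_sites, translate, cube]

theorem sites_tile_subset {m : ℕ+} {s : ℕ} {n : ℕ+} (j : Fin (tileCount d m s n)) :
    (tile d m s n j).sites ⊆ (cube d n).sites := by
  intro w hw
  refine mem_sites.2 fun i => ?_
  obtain ⟨hlow, hup⟩ := mem_sites_tile.1 hw i
  set k : ℕ := (finFunctionFinEquiv.symm j i : ℕ)
  have hk : k + 1 ≤ (n : ℕ) / (m + s) := (finFunctionFinEquiv.symm j i).2
  have hperiods : ((m + s : ℕ) : ℤ) * (k + 1) ≤ ((n : ℕ) : ℤ) := by
    exact_mod_cast (Nat.mul_le_mul_left _ hk).trans (Nat.mul_div_le _ _)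
  have hnonneg : (0 : ℤ) ≤ ((m + s : ℕ) : ℤ) * k := by positivity
  simp only [cube, Pi.zero_apply, zero_add]
  push_cast at *
  constructor <;> linarith

theorem lt_dist_of_mem_tile {m : ℕ+} {s n : ℕ} {j j' : Fin (tileCount d m s n)} (hj : j ≠ j')
    {v w : Fin d → ℤ} (hv : v ∈ (tile d m s n j).sites) (hw : w ∈ (tile d m s n j').sites) :
    (s : ℝ) < dist v w := by
  obtain ⟨i, hi⟩ := Function.ne_iff.1 (finFunctionFinEquiv.symm.injective.ne hj)
  refine lt_of_lt_of_le ?_ (dist_le_pi_dist v w i)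
  obtain ⟨hv_low, hv_up⟩ := mem_sites_tile.1 hv i
  obtain ⟨hw_low, hw_up⟩ := mem_sites_tile.1 hw i
  have hne := Fin.val_ne_of_ne hi
  set a : ℕ := (finFunctionFinEquiv.symm j i : ℕ)
  set b : ℕ := (finFunctionFinEquiv.symm j' i : ℕ)
  have hlt : (s : ℤ) < |v i - w i| := by
    rw [lt_abs]
    push_cast at hv_low hv_up hw_low hw_up
    rcases lt_or_gt_of_ne hne with h | h
    · have : ((m : ℕ) + (s : ℤ)) * ((a : ℤ) + 1) ≤ ((m : ℕ) + (s : ℤ)) * b := by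
        gcongr; exact_mod_cast h
      right; linarith
    · have : ((m : ℕ) + (s : ℤ)) * ((b : ℤ) + 1) ≤ ((m : ℕ) + (s : ℤ)) * a := by
        gcongr; exact_mod_cast h
      left; linarith
  rw [Int.dist_eq]
  exact_mod_cast hlt

theorem pairwise_disjoint_tile (d : ℕ) (m : ℕ+) (s n : ℕ) :
    Pairwise fun j j' : Fin (tileCount d m s n) =>
      Disjoint (tile d m s n j).sites (tile d m s n j').sites := by
  refine fun j j' hj => Finset.disjoint_left.2 fun v hv hw => ?_
  have := lt_dist_of_mem_tile hj hv hw
  rw [dist_self] at this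
  exact this.not_ge (Nat.cast_nonneg s)

/-- The sites lying in some tile. -/
noncomputable def tiledSites (d : ℕ) (m : ℕ+) (s n : ℕ) : Finset (Fin d → ℤ) :=
  Finset.univ.biUnion fun j : Fin (tileCount d m s n) => (tile d m s n j).sites

theorem tiledSites_subset (d : ℕ) (m : ℕ+) (s : ℕ) (n : ℕ+) :
    tiledSites d m s n ⊆ (cube d n).sites :=
  Finset.biUnion_subset.2 fun j _ => sites_tile_subset j

theorem sites_tile_subset_tiledSites {m : ℕ+} {s n : ℕ} (j : Fin (tileCount d m s n)) :
    (tile d m s n j).sites ⊆ tiledSites d m s n :=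
  Finset.subset_biUnion_of_mem (fun j => (tile d m s n j).sites) (Finset.mem_univ j)

theorem card_sites_tile {m : ℕ+} {s n : ℕ} (j : Fin (tileCount d m s n)) :
    (tile d m s n j).sites.card = (cube d m).sites.card := by
  simp only [card_sites, tile, translate]

theorem card_tiledSites (d : ℕ) (m : ℕ+) (s n : ℕ) :
    (tiledSites d m s n).card = tileCount d m s n * (cube d m).sites.card := by
  rw [tiledSites, Finset.card_biUnion fun j _ j' _ h => pairwise_disjoint_tile d m s n h]
  simp [card_sites_tile]

/-- The sites of the cube of side `n` which lie in no tile. -/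
noncomputable def gaps (d : ℕ) (m : ℕ+) (s : ℕ) (n : ℕ+) : Finset (Fin d → ℤ) :=
  (cube d n).sites \ tiledSites d m s n

/-- The proportion of the sites of the cube of side `n` which lie in some tile. -/
noncomputable def tileDensity (d : ℕ) (m : ℕ+) (s : ℕ) (n : ℕ+) : ℝ :=
  (tiledSites d m s n).card / (cube d n).sites.card

theorem card_mul_tileDensity (d : ℕ) (m : ℕ+) (s : ℕ) (n : ℕ+) :
    (cube d n).sites.card * tileDensity d m s n =
      tileCount d m s n * (cube d m).sites.card := by
  rw [tileDensity, mul_div_cancel₀ _ (card_sites_cube_pos d n).ne', card_tiledSites, Nat.cast_mul]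

theorem card_mul_one_sub_tileDensity (d : ℕ) (m : ℕ+) (s : ℕ) (n : ℕ+) :
    (cube d n).sites.card * (1 - tileDensity d m s n) = (gaps d m s n).card := by
  rw [gaps, Finset.cast_card_sdiff (tiledSites_subset d m s n), card_tiledSites, mul_sub,
    card_mul_tileDensity]
  push_cast
  ring

end LatticeBox

open LatticeBox

variable {X : Type*} [AddCommGroup X] [Module ℝ X] {d : ℕ}

/-- The means of a configuration over the tiles. -/
noncomputable def tileMeans (m : ℕ+) (s n : ℕ) (σ : Config d X) : Fin (tileCount d m s n) → X :=
  fun j => empMean (tile d m s n j) σ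

theorem card_smul_empMean_cube (m : ℕ+) (s : ℕ) (n : ℕ+) (σ : Config d X) :
    ((cube d n).sites.card : ℝ) • empMean (cube d n) σ =
      ((cube d m).sites.card : ℝ) • ∑ j, tileMeans m s n σ j + ∑ z ∈ gaps d m s n, σ z := by
  have htile : ∀ j, ((cube d m).sites.card : ℝ) • tileMeans m s n σ j =
      ∑ z ∈ (tile d m s n j).sites, σ z := fun j => by
    rw [← card_smul_empMean, card_sites_tile, tileMeans]
  rw [card_smul_empMean, gaps, ← Finset.sum_sdiff (tiledSites_subset d m s n), add_comm,
    tiledSites, Finset.sum_biUnion fun j _ j' _ h => pairwise_disjoint_tile d m s n h,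
    Finset.smul_sum]
  simp only [htile]

theorem seminorm_empMean_cube_sub_le (p : Seminorm ℝ X) {m : ℕ+} {s : ℕ} {n : ℕ+}
    {σ : Config d X} {y : X} {r t : ℝ}
    (htiles : p (∑ j, tileMeans m s n σ j - (tileCount d m s n : ℝ) • y) ≤
      tileCount d m s n * r)
    (hgaps : ∀ z ∈ gaps d m s n, p (σ z) ≤ t) :
    p (empMean (cube d n) σ - tileDensity d m s n • y) ≤
      tileDensity d m s n * r + (1 - tileDensity d m s n) * t := by
  have hN := card_sites_cube_pos d n
  have hM := card_sites_cube_pos d m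
  have hρ := card_mul_tileDensity d m s n
  set N : ℝ := ((cube d n).sites.card : ℝ)
  set M : ℝ := ((cube d m).sites.card : ℝ)
  set T : ℝ := (tileCount d m s n : ℝ)
  set ρ := tileDensity d m s n
  have hsmul : ∀ {b : ℝ}, 0 ≤ b → ∀ x, p (b • x) = b * p x := fun hb x => by
    rw [map_smul_eq_mul, Real.norm_of_nonneg hb]
  refine le_of_mul_le_mul_left ?_ hN
  calc N * p (empMean (cube d n) σ - ρ • y)
      = p (M • (∑ j, tileMeans m s n σ j - T • y) + ∑ z ∈ gaps d m s n, σ z) := by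
        rw [← hsmul hN.le, smul_sub, card_smul_empMean_cube m s n σ, smul_smul, hρ]
        congr 1
        module
    _ ≤ M * p (∑ j, tileMeans m s n σ j - T • y) + ∑ z ∈ gaps d m s n, p (σ z) := by
        rw [← hsmul hM.le]
        exact (map_add_le_add p _ _).trans (by gcongr; exact seminorm_sum_le p _ _)
    _ ≤ M * (T * r) + (gaps d m s n).card * t := by
        rw [← nsmul_eq_mul (gaps d m s n).card]
        gcongr
        exact Finset.sum_le_card_nsmul _ _ _ hgaps
    _ = N * (ρ * r + (1 - ρ) * t) := by
        rw [← card_mul_one_sub_tileDensity]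
        linear_combination (-r) * hρ

variable [MeasurableSpace X]

theorem measurable_tileMeans (d : ℕ) (m : ℕ+) (s n : ℕ) :
    @Measurable _ _ (fieldSigma X (tiledSites d m s n)) _
      (tileMeans m s n : Config d X → Fin (tileCount d m s n) → X) :=
  @measurable_pi_lambda _ _ _ (fieldSigma X _) _ _
    fun j => measurable_empMean (sites_tile_subset_tiledSites j)

namespace InvariantSystem

variable {μ : InvariantSystem d X} {m : ℕ+} {s : ℕ} {g c : ℝ}

theorem DecoupledAt.prod_cramer_le_law (h : μ.DecoupledAt m g c) (hs : g ≤ s) {n : ℕ+}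
    {A : Fin (tileCount d m s n) → Set X} (hA : ∀ j, MeasurableSet (A j))
    (J : Finset (Fin (tileCount d m s n))) :
    ENNReal.ofReal (Real.exp (-c)) ^ J.card * ∏ j ∈ J, μ.cramer m (A j) ≤
      μ.law (cube d n) (⋂ j ∈ J, empMean (tile d m s n j) ⁻¹' A j) := by
  induction J using Finset.induction_on with
  | empty => simp [μ.law_univ]
  | insert j J hj ih =>
    have hmeas : MeasurableSet[fieldSigma X (J.biUnion fun j => (tile d m s n j).sites)]
        (⋂ j ∈ J, empMean (tile d m s n j) ⁻¹' A j) :=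
      @Finset.measurableSet_biInter _ _ (fieldSigma X _) _ J fun j hj => measurable_empMean
        (Finset.subset_biUnion_of_mem (fun j => (tile d m s n j).sites) hj) (hA j)
    rw [Finset.card_insert_of_notMem hj, Finset.prod_insert hj, Finset.set_biInter_insert]
    calc ENNReal.ofReal (Real.exp (-c)) ^ (J.card + 1) *
          (μ.cramer m (A j) * ∏ j ∈ J, μ.cramer m (A j))
        = ENNReal.ofReal (Real.exp (-c)) * μ.cramer m (A j) *
            (ENNReal.ofReal (Real.exp (-c)) ^ J.card * ∏ j ∈ J, μ.cramer m (A j)) := by ring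
      _ ≤ _ := by gcongr
      _ ≤ _ := h.translate (sites_tile_subset j)
        (Finset.biUnion_subset.2 fun j _ => sites_tile_subset j) (fun v hv w hw => ?_) (hA j) hmeas
    obtain ⟨j', hj', hv⟩ := Finset.mem_biUnion.1 hv
    exact hs.trans_lt (lt_dist_of_mem_tile (ne_of_mem_of_not_mem hj' hj) hv hw)

theorem DecoupledAt.pi_cramer_le_law (h : μ.DecoupledAt m g c) (hs : g ≤ s) (n : ℕ+)
    {B : Set (Fin (tileCount d m s n) → X)} (hB : MeasurableSet B) :
    ENNReal.ofReal (Real.exp (-c)) ^ tileCount d m s n * Measure.pi (fun _ => μ.cramer m) B ≤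
      μ.law (cube d n) (tileMeans m s n ⁻¹' B) := by
  have hmeas : @Measurable _ _ (fieldSigma X (cube d n).sites) _
      (tileMeans m s n : Config d X → _) :=
    (measurable_tileMeans d m s n).mono (fieldSigma_mono (tiledSites_subset d m s n)) le_rfl
  have := μ.isProbabilityMeasure_law (cube d n)
  let ρ := @Measure.map _ _ (fieldSigma X (cube d n).sites) _ (tileMeans m s n) (μ.law (cube d n))
  have hρ : ∀ {B}, MeasurableSet B → ρ B = μ.law (cube d n) (tileMeans m s n ⁻¹' B) :=
    fun hB => @Measure.map_apply _ _ (fieldSigma X _) _ _ _ hmeas _ hB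
  have : IsProbabilityMeasure ρ := ⟨by rw [hρ .univ]; exact μ.law_univ _⟩
  have hle := smul_pi_le_of_rectangles (P := fun _ => μ.cramer m) (ρ := ρ)
    (Real.toNNReal (Real.exp (-c)) ^ tileCount d m s n) fun A hA => ?_
  · rw [← hρ hB]
    simpa [ENNReal.ofReal] using hle B
  · rw [hρ (.univ_pi hA)]
    have hinter : tileMeans m s n ⁻¹' Set.univ.pi A =
        ⋂ j ∈ Finset.univ, empMean (tile d m s n j) ⁻¹' A j := by
      ext σ
      simp [tileMeans]
    rw [hinter]
    simpa [ENNReal.ofReal] using h.prod_cramer_le_law hs hA Finset.univ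

theorem SpinLowerBound.pow_mul_law_le {E : Set X} {a : ℝ} (h : μ.SpinLowerBound E a)
    (hE : MeasurableSet E) {Λ : LatticeBox d} {S G : Finset (Fin d → ℤ)} (hS : S ⊆ Λ.sites)
    (hG : G ⊆ Λ.sites) (hd : Disjoint S G) {B : Set (Config d X)}
    (hB : MeasurableSet[fieldSigma X S] B) :
    ENNReal.ofReal a ^ G.card * μ.law Λ B ≤ μ.law Λ ((⋂ z ∈ G, {σ | σ z ∈ E}) ∩ B) := by
  induction G using Finset.induction_on with
  | empty => simp
  | insert z G hz ih =>
    rw [Finset.insert_subset_iff] at hG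
    rw [Finset.disjoint_insert_right] at hd
    have hmeas : MeasurableSet[fieldSigma X (S ∪ G)]
        ((⋂ z ∈ G, {σ : Config d X | σ z ∈ E}) ∩ B) :=
      @MeasurableSet.inter _ (fieldSigma X _) _ _
        (@Finset.measurableSet_biInter _ _ (fieldSigma X _) _ G fun w hw =>
          measurable_eval (Finset.mem_union_right _ hw) hE)
        (fieldSigma_mono Finset.subset_union_left _ hB)
    rw [Finset.card_insert_of_notMem hz, Finset.set_biInter_insert, Set.inter_assoc, pow_succ',
      mul_assoc]
    calc _ ≤ ENNReal.ofReal a * μ.law Λ ((⋂ z ∈ G, {σ | σ z ∈ E}) ∩ B) := by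
          gcongr
          exact ih hG.2 hd.2
      _ ≤ _ := h.ofReal_mul_law_le hE hG.1 (Finset.union_subset hS hG.2) (by simp [hz, hd.1])
          hmeas

theorem DecoupledAt.ofReal_exp_le_cramer_ball (h : μ.DecoupledAt m g c) (hs : g ≤ s)
    {p : Seminorm ℝ X} (hmeas : ∀ y r, MeasurableSet (p.ball y r)) {t a : ℝ} (ha : 0 < a)
    (hspin : μ.SpinLowerBound (p.ball 0 t) a) {n : ℕ+} {B : Set (Fin (tileCount d m s n) → X)}
    (hB : MeasurableSet B) {y : X} {r r' κ : ℝ}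
    (hBy : ∀ v ∈ B, p (∑ j, v j - (tileCount d m s n : ℝ) • y) ≤ tileCount d m s n * r)
    (hκ : ENNReal.ofReal (Real.exp (tileCount d m s n * κ)) ≤ Measure.pi (fun _ => μ.cramer m) B)
    (hr : tileDensity d m s n * r + (1 - tileDensity d m s n) * t < r') :
    ENNReal.ofReal (Real.exp ((gaps d m s n).card * Real.log a + tileCount d m s n * (κ - c))) ≤
      μ.cramer n (p.ball (tileDensity d m s n • y) r') := by
  let T := tileCount d m s n
  let G := gaps d m s n
  calc ENNReal.ofReal (Real.exp (G.card * Real.log a + T * (κ - c)))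
      = ENNReal.ofReal a ^ G.card * (ENNReal.ofReal (Real.exp (-c)) ^ T *
          ENNReal.ofReal (Real.exp (T * κ))) := by
        rw [← ENNReal.ofReal_pow ha.le, ← ENNReal.ofReal_pow (Real.exp_nonneg _),
          ← Real.exp_nat_mul, ← ENNReal.ofReal_mul (Real.exp_nonneg _), ← Real.exp_add,
          ← ENNReal.ofReal_mul (pow_nonneg ha.le _), Real.exp_add, Real.exp_nat_mul,
          Real.exp_log ha]
        ring_nf
    _ ≤ ENNReal.ofReal a ^ G.card * μ.law (cube d n) (tileMeans m s n ⁻¹' B) := by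
        gcongr
        exact (mul_le_mul_right hκ _).trans (h.pi_cramer_le_law hs n hB)
    _ ≤ μ.law (cube d n) ((⋂ z ∈ G, {σ | σ z ∈ p.ball 0 t}) ∩ tileMeans m s n ⁻¹' B) :=
        hspin.pow_mul_law_le (hmeas _ _) (tiledSites_subset d m s n) Finset.sdiff_subset
          Finset.disjoint_sdiff (measurable_tileMeans d m s n hB)
    _ ≤ μ.law (cube d n) (empMean (cube d n) ⁻¹' p.ball (tileDensity d m s n • y) r') := by
        refine measure_mono fun σ hσ => p.mem_ball.2 (lt_of_le_of_lt ?_ hr)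
        refine seminorm_empMean_cube_sub_le p (hBy _ hσ.2) fun z hz => ?_
        exact (p.mem_ball_zero.1 (Set.mem_iInter₂.1 hσ.1 z hz)).le
    _ = _ := (μ.cramer_apply_eq_law subset_rfl (hmeas _ _)).symm

end InvariantSystem

end Tiles

section Asymptotics

namespace LatticeBox

theorem tendsto_natDiv_div_atTop (k : ℕ) :
    Tendsto (fun n : ℕ+ => (((n : ℕ) / k : ℕ) : ℝ) / (n : ℕ)) atTop (𝓝 (k : ℝ)⁻¹) := by
  refine ((tendsto_nat_floor_mul_div_atTop (R := ℝ) (a := (k : ℝ)⁻¹) (by positivity)).comp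
    (tendsto_natCast_atTop_atTop.comp tendsto_PNat_val_atTop_atTop)).congr fun n => ?_
  simp only [Function.comp_apply, inv_mul_eq_div, Nat.floor_div_eq_div]

theorem tendsto_tileDensity (d : ℕ) (m : ℕ+) (s : ℕ) :
    Tendsto (tileDensity d m s) atTop (𝓝 (((m : ℕ) / (m + s : ℕ) : ℝ) ^ d)) := by
  have h := ((tendsto_natDiv_div_atTop (m + s)).const_mul ((m : ℕ) : ℝ)).pow d
  rw [← div_eq_mul_inv] at h
  refine h.congr fun n => ?_
  rw [tileDensity, card_tiledSites, card_sites_cube, card_sites_cube]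
  push_cast
  rw [mul_pow, div_pow]
  ring

theorem tendsto_tileCount {d : ℕ} (hd : 0 < d) (m : ℕ+) (s : ℕ) :
    Tendsto (fun n : ℕ+ => tileCount d m s n) atTop atTop :=
  (tendsto_pow_atTop hd.ne').comp
    ((Nat.tendsto_div_const_atTop (by have := m.pos; lia)).comp tendsto_PNat_val_atTop_atTop)

theorem tendsto_div_add_ceil_pow {g : ℕ+ → ℝ} (hg : ∀ m, 0 ≤ g m)
    (h : Tendsto (fun m : ℕ+ => g m / (m : ℝ)) atTop (𝓝 0)) (d : ℕ) :
    Tendsto (fun m : ℕ+ => ((m : ℕ) / (m + ⌈g m⌉₊ : ℕ) : ℝ) ^ d) atTop (𝓝 1) := by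
  have hinv : Tendsto (fun m : ℕ+ => (1 : ℝ) / (m : ℝ)) atTop (𝓝 0) :=
    tendsto_one_div_atTop_nhds_zero_nat.comp tendsto_PNat_val_atTop_atTop
  have hceil : Tendsto (fun m : ℕ+ => (⌈g m⌉₊ : ℝ) / (m : ℝ)) atTop (𝓝 0) := by
    refine squeeze_zero (fun m => by positivity) (fun m => ?_) (add_zero (0 : ℝ) ▸ h.add hinv)
    rw [← add_div]
    gcongr
    exact (Nat.ceil_lt_add_one (hg m)).le
  have hlim : Tendsto (fun m : ℕ+ => (1 + (⌈g m⌉₊ : ℝ) / (m : ℝ))⁻¹ ^ d) atTop (𝓝 1) := by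
    simpa using ((hceil.const_add 1).inv₀ (by norm_num)).pow d
  refine hlim.congr fun m => ?_
  have : (0 : ℝ) < (m : ℕ) := by exact_mod_cast m.pos
  push_cast
  field_simp

end LatticeBox

namespace InvariantSystem

open LatticeBox

variable {X : Type*} [AddCommGroup X] [Module ℝ X] [MeasurableSpace X] {d : ℕ}
  (μ : InvariantSystem d X) {p : Seminorm ℝ X}

/-- A lower bound `R` for the exponential rate of the probability, under the Cramér sequence, of
the ball of radius `η` around `y`. -/
def RateAtLeast (p : Seminorm ℝ X) (y : X) (η R : ℝ) : Prop :=
  ∀ᶠ n : ℕ+ in atTop,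
    ENNReal.ofReal (Real.exp ((cube d n).sites.card * R)) ≤ μ.cramer n (p.ball y η)

variable {μ}

theorem RateAtLeast.mono {y y' : X} {η η' R R' : ℝ} (h : μ.RateAtLeast p y η R)
    (hball : p.ball y η ⊆ p.ball y' η') (hR : R' ≤ R) : μ.RateAtLeast p y' η' R' := by
  filter_upwards [h] with n hn
  exact (ENNReal.ofReal_le_ofReal (by gcongr)).trans (hn.trans (measure_mono hball))

variable {t a : ℝ}

theorem DecoupledAt.rateAtLeast {m : ℕ+} {g c : ℝ} (h : μ.DecoupledAt m g c) (hd : 0 < d) {s : ℕ}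
    (hs : g ≤ s) (hmeas : ∀ y r, MeasurableSet (p.ball y r)) (ha : 0 < a)
    (hspin : μ.SpinLowerBound (p.ball 0 t) a) {ρ : ℝ}
    (hρ : Tendsto (tileDensity d m s) atTop (𝓝 ρ)) {y : X} {r r' R R' : ℝ}
    (hsum : SumsNear p (μ.cramer m) y r ((cube d m).sites.card * R))
    (hr : ρ * r + (1 - ρ) * t < r')
    (hR : R' < (1 - ρ) * Real.log a + ρ * (R - c / (cube d m).sites.card)) :
    μ.RateAtLeast p (ρ • y) r' R' := by
  have hM := card_sites_cube_pos d m
  have hradius : ∀ᶠ n in atTop, tileDensity d m s n * r + (1 - tileDensity d m s n) * t +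
      |tileDensity d m s n - ρ| * p y < r' :=
    (((hρ.mul_const r).add ((hρ.const_sub 1).mul_const t)).add
      ((hρ.sub_const ρ).abs.mul_const (p y))).eventually_lt_const (by simpa using hr)
  have hrate := (((hρ.const_sub 1).mul_const (Real.log a)).add
    (hρ.mul_const (R - c / (cube d m).sites.card))).eventually_const_lt hR
  filter_upwards [hradius, hrate, (tendsto_tileCount hd m s).eventually hsum]
    with n hradius hrate ⟨B, hB, hBy, hBκ⟩
  refine (ENNReal.ofReal_le_ofReal (Real.exp_le_exp.2 ?_)).trans
    ((h.ofReal_exp_le_cramer_ball hs hmeas ha hspin hB hBy hBκ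
      (lt_sub_iff_add_lt.2 hradius)).trans (measure_mono fun x hx => ?_))
  · refine (mul_le_mul_of_nonneg_left hrate.le (card_sites_cube_pos d n).le).trans_eq ?_
    rw [← card_mul_one_sub_tileDensity, mul_add, ← mul_assoc, ← mul_assoc, card_mul_tileDensity]
    field_simp
  · rw [p.mem_ball] at hx ⊢
    have hsplit : x - ρ • y = (x - tileDensity d m s n • y) + (tileDensity d m s n - ρ) • y := by
      module
    have hshift : p ((tileDensity d m s n - ρ) • y) = |tileDensity d m s n - ρ| * p y := by
      rw [map_smul_eq_mul, Real.norm_eq_abs]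
    rw [hsplit]
    linarith [map_add_le_add p (x - tileDensity d m s n • y) ((tileDensity d m s n - ρ) • y)]

theorem LowerAsymptoticallyDecoupled.eventually_rateAtLeast (hdec : μ.LowerAsymptoticallyDecoupled)
    (hd : 0 < d) (hmeas : ∀ y r, MeasurableSet (p.ball y r)) (ha : 0 < a)
    (hspin : μ.SpinLowerBound (p.ball 0 t) a) {δ : ℝ} (hδ : 0 < δ) :
    ∀ᶠ m : ℕ+ in atTop, ∃ ρ ∈ Set.Icc (1 - δ) 1, ∀ {y : X} {r R : ℝ}, 0 ≤ r →
      SumsNear p (μ.cramer m) y r ((cube d m).sites.card * R) →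
        μ.RateAtLeast p (ρ • y) (r + δ) (ρ * R - δ) := by
  obtain ⟨g, c, hg, -, hgm, hcm, h⟩ := hdec
  have hρ := tendsto_div_add_ceil_pow hg hgm d
  have hradius := ((hρ.const_sub 1).mul_const t).eventually_lt_const (by simpa using hδ)
  have hdensity := hρ.eventually_const_lt (sub_lt_self 1 hδ)
  have hrate := (((hρ.const_sub 1).mul_const (Real.log a)).sub (hρ.mul hcm)).eventually_const_lt
    (show -δ < (1 - 1) * Real.log a - 1 * 0 by simpa using hδ)
  filter_upwards [hradius, hdensity, hrate] with m hradius hdensity hrate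
  have hρ₁ : ((m : ℕ) / (m + ⌈g m⌉₊ : ℕ) : ℝ) ^ d ≤ 1 :=
    pow_le_one₀ (by positivity) (div_le_one_of_le₀ (by push_cast; simp) (by positivity))
  refine ⟨_, ⟨hdensity.le, hρ₁⟩, fun {y r R} hr hsum => ?_⟩
  refine DecoupledAt.rateAtLeast (h m) hd (Nat.le_ceil _) hmeas ha hspin
    (tendsto_tileDensity d m ⌈g m⌉₊) hsum ?_ ?_
  · linarith [mul_le_of_le_one_left hr hρ₁]
  · rw [mul_sub]
    linarith

end InvariantSystem

end Asymptotics

section Seminorms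

variable {X : Type*} [AddCommGroup X] [Module ℝ X]

theorem seminorm_ball_eq_vadd_smul (p : Seminorm ℝ X) (y : X) {r : ℝ} (hr : 0 < r) :
    p.ball y r = y +ᵥ (r • p.ball 0 1) := by
  simp [Seminorm.smul_ball_zero hr.ne', Seminorm.vadd_ball, abs_of_pos hr]

theorem seminorm_le_of_ball_subset_ball {p q : Seminorm ℝ X} (h : p.ball 0 1 ⊆ q.ball 0 1) :
    q ≤ p := fun x => by
  rw [← p.gauge_ball, ← q.gauge_ball]
  exact gauge_mono (p.absorbent_ball_zero one_pos) h x

theorem balanced_of_neg_eq {C : Set X} (hC : Convex ℝ C) (hneg : -C = C) : Balanced ℝ C := by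
  rintro a ha _ ⟨x, hx, rfl⟩
  have hneg_mem : -x ∈ C := by rwa [← hneg, Set.neg_mem_neg]
  rw [Real.norm_eq_abs, abs_le] at ha
  have hcomb := hC hneg_mem hx (a := (1 - a) / 2) (b := (1 + a) / 2) (by linarith) (by linarith)
    (by ring)
  convert hcomb using 1
  module

theorem IsInternalConvex.gauge_lt_one {C : Set X} (hC : IsInternalConvex C) {x : X}
    (hx : x ∈ C) : gauge C x < 1 := by
  rw [hC.eq_gauge_lt_one] at hx
  simp only [Set.mem_ofPred_eq, extGauge, iInf_lt_iff] at hx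
  obtain ⟨t, hxt, ht⟩ := hx
  exact (gauge_le_of_mem t.2 hxt).trans_lt (by exact_mod_cast ht)

namespace IsMeasurableLCS

variable [TopologicalSpace X] [MeasurableSpace X] {C₀ : Set (Set X)}

theorem measurableSet_ball (hX : IsMeasurableLCS C₀) {p : Seminorm ℝ X} (hp : p.ball 0 1 ∈ C₀)
    (y : X) (r : ℝ) : MeasurableSet (p.ball y r) := by
  rcases le_or_gt r 0 with hr | hr
  · rw [p.ball_eq_emptyset hr]
    exact .empty
  · rw [seminorm_ball_eq_vadd_smul p y hr]
    exact hX.measurableSet_vadd _ _ (hX.measurableSet_smul _ _ hr.ne' (hX.subset hp).2)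

variable [IsTopologicalAddGroup X] [ContinuousSMul ℝ X]

theorem exists_seminorm (hX : IsMeasurableLCS C₀) {C : Set X} (hC : C ∈ C₀) :
    ∃ p : Seminorm ℝ X, Continuous p ∧ p.ball 0 1 = C := by
  have hint := (hX.subset hC).1
  have hnhds : C ∈ 𝓝 (0 : X) := hX.nhds_zero_basis.mem_of_mem hC
  have habs : Absorbent ℝ C := absorbent_nhds_zero hnhds
  refine ⟨gaugeSeminorm (balanced_of_neg_eq hint.convex (hX.symmetric C hC)) hint.convex habs,
    continuous_gauge hint.convex hnhds, Set.ext fun x => ?_⟩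
  rw [Seminorm.mem_ball_zero]
  exact ⟨fun h => setOfPred_gauge_lt_one_subset_self hint.convex (mem_of_mem_nhds hnhds) habs h,
    hint.gauge_lt_one⟩

theorem exists_seminorm_ge (hX : IsMeasurableLCS C₀) {q : Seminorm ℝ X} (hq : Continuous q) :
    ∃ p : Seminorm ℝ X, p.ball 0 1 ∈ C₀ ∧ q ≤ p := by
  obtain ⟨C, hC, hCq⟩ := hX.nhds_zero_basis.mem_iff.1 (Seminorm.ball_mem_nhds hq one_pos)
  obtain ⟨p, -, rfl⟩ := hX.exists_seminorm hC
  exact ⟨p, hC, seminorm_le_of_ball_subset_ball hCq⟩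

end IsMeasurableLCS

end Seminorms

section HahnBanach

variable {X : Type*} [AddCommGroup X] [Module ℝ X] [TopologicalSpace X]

theorem exists_mem_nhds_zero_pos [ContinuousSMul ℝ X] {l : X →L[ℝ] ℝ} (hl : l ≠ 0) {V : Set X}
    (hV : V ∈ 𝓝 0) : ∃ c ∈ V, 0 < l c := by
  obtain ⟨z, hz⟩ : ∃ z, 0 < l z := by
    obtain ⟨z, hz⟩ := ContinuousLinearMap.exists_ne_zero hl
    rcases hz.lt_or_gt with h | h
    · exact ⟨-z, by simpa using h⟩
    · exact ⟨z, h⟩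
  have hsmul : Tendsto (fun t : ℝ => t • z) (𝓝[>] 0) (𝓝 0) :=
    ((continuous_id.smul continuous_const).tendsto' 0 0 (zero_smul ℝ z)).mono_left
      nhdsWithin_le_nhds
  obtain ⟨t, htV, ht⟩ := ((hsmul.eventually_mem hV).and self_mem_nhdsWithin).exists
  exact ⟨t • z, htV, by simpa using mul_pos ht hz⟩

theorem continuousLinearMap_prod_apply (f : X × ℝ →L[ℝ] ℝ) (y : X) (r : ℝ) :
    f (y, r) = f.comp (ContinuousLinearMap.inl ℝ X ℝ) y + r * f (0, 1) := by
  have hsplit : (y, r) = (y, (0 : ℝ)) + r • ((0 : X), (1 : ℝ)) := by simp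
  rw [hsplit, map_add, map_smul, smul_eq_mul]
  rfl

variable {G : Set (X × ℝ)} {x : X} {a : ℝ}

theorem nonneg_of_forall_add_mul_lt {l : X →L[ℝ] ℝ} {β A : ℝ} (hne : G.Nonempty)
    (hdown : ∀ {y : X} {r r' : ℝ}, (y, r) ∈ G → r' ≤ r → (y, r') ∈ G)
    (hlt : ∀ {y : X} {r : ℝ}, (y, r) ∈ G → l y + r * β < A) : 0 ≤ β := by
  by_contra! hβ
  obtain ⟨⟨y, r⟩, hy⟩ := hne
  have hle := mul_le_mul_of_nonpos_right (min_le_right r ((A - l y) / β)) hβ.le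
  rw [div_mul_cancel₀ _ hβ.ne] at hle
  linarith [hlt (hdown hy (min_le_left r ((A - l y) / β)))]

/-- The neighbourhood `V` excludes a vertical separating hyperplane. -/
theorem mem_of_forall_exists_lt [IsTopologicalAddGroup X] [ContinuousSMul ℝ X]
    (hopen : IsOpen G) (hconv : Convex ℝ G)
    (hdown : ∀ {y : X} {r r' : ℝ}, (y, r) ∈ G → r' ≤ r → (y, r') ∈ G) {b : ℝ}
    (hbdd : ∀ {y : X} {r : ℝ}, (y, r) ∈ G → r ≤ b) {V : Set X} (hV : V ∈ 𝓝 0)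
    (h : ∀ l : X →L[ℝ] ℝ, ∃ y r, a + l x < l y + r ∧ ∀ c ∈ V, (y + c, r) ∈ G) :
    (x, a) ∈ G := by
  by_contra hnot
  have hmem : ∀ {y : X} {r : ℝ}, (∀ c ∈ V, (y + c, r) ∈ G) → (y, r) ∈ G := fun h => by
    simpa using h 0 (mem_of_mem_nhds hV)
  obtain ⟨f, hf⟩ := geometric_hahn_banach_open_point hconv hopen hnot
  set l : X →L[ℝ] ℝ := f.comp (ContinuousLinearMap.inl ℝ X ℝ)
  set β : ℝ := f (0, 1)
  have hsep : ∀ {y : X} {r : ℝ}, (y, r) ∈ G → l y + r * β < l x + a * β :=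
    fun {y r} hq => by
      rw [← continuousLinearMap_prod_apply f y r, ← continuousLinearMap_prod_apply f x a]
      exact hf _ hq
  obtain ⟨y₀, r₀, -, hG₀⟩ := h 0
  rcases (nonneg_of_forall_add_mul_lt ⟨_, hmem hG₀⟩ hdown hsep).eq_or_lt with hβ | hβ
  · simp only [← hβ, mul_zero, add_zero] at hsep
    have hl : l ≠ 0 := fun hl => by simpa [hl] using hsep (hmem hG₀)
    obtain ⟨c, hcV, hc⟩ := exists_mem_nhds_zero_pos hl hV
    obtain ⟨y, r, hyr, hG⟩ := h ((|b - a| / l c) • l)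
    simp only [_root_.smul_apply, smul_eq_mul] at hyr
    have hslope : |b - a| / l c * l (y + c) ≤ |b - a| / l c * l x :=
      mul_le_mul_of_nonneg_left (hsep (hG c hcV)).le (by positivity)
    rw [map_add, mul_add, div_mul_cancel₀ _ hc.ne'] at hslope
    linarith [hbdd (hmem hG), le_abs_self (b - a)]
  · obtain ⟨y, r, hyr, hG⟩ := h (β⁻¹ • l)
    simp only [_root_.smul_apply, smul_eq_mul] at hyr
    have hscaled := mul_lt_mul_of_pos_left hyr hβ
    rw [mul_add, mul_add, mul_inv_cancel_left₀ hβ.ne', mul_inv_cancel_left₀ hβ.ne'] at hscaled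
    linarith [hsep (hmem hG)]

end HahnBanach

section RateSet

open LatticeBox

variable {X : Type*} [AddCommGroup X] [Module ℝ X] [MeasurableSpace X] {d : ℕ}

theorem sub_mul_abs_le_mul {ρ δ : ℝ} (hρ : ρ ∈ Set.Icc (1 - δ) 1) (R : ℝ) :
    R - δ * |R| ≤ ρ * R := by
  have hle : (1 - ρ) * R ≤ δ * |R| :=
    (mul_le_mul_of_nonneg_left (le_abs_self R) (by linarith [hρ.2])).trans
      (mul_le_mul_of_nonneg_right (by linarith [hρ.1]) (abs_nonneg R))
  linarith

namespace InvariantSystem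

variable {μ : InvariantSystem d X} {p : Seminorm ℝ X}

/-- The pairs `(y, r)` such that some ball around `y` of radius `< 1` has an exponential rate
`> r`. Both inequalities are strict in order to make the set open. -/
def rateSet (μ : InvariantSystem d X) (p : Seminorm ℝ X) : Set (X × ℝ) :=
  {q | ∃ η < 1, ∃ R > q.2, μ.RateAtLeast p q.1 η R}

theorem RateAtLeast.mem_rateSet {y y' : X} {η R r : ℝ} (h : μ.RateAtLeast p y η R)
    (hy : η + p (y - y') < 1) (hr : r < R) : (y', r) ∈ μ.rateSet p := by
  refine ⟨η + p (y - y'), hy, R, hr, h.mono (fun x hx => ?_) le_rfl⟩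
  rw [p.mem_ball] at hx ⊢
  linarith [sub_add_sub_cancel x y y' ▸ map_add_le_add p (x - y) (y - y')]

theorem nonpos_of_mem_rateSet {y : X} {r : ℝ} (h : (y, r) ∈ μ.rateSet p) : r ≤ 0 := by
  obtain ⟨η, -, R, hR, h⟩ := h
  obtain ⟨n, hn⟩ := h.exists
  have hexp := ENNReal.ofReal_le_one.1 (hn.trans prob_le_one)
  rw [Real.exp_le_one_iff] at hexp
  exact hR.le.trans (nonpos_of_mul_nonpos_right hexp (card_sites_cube_pos d n))

theorem mem_rateSet_of_le {y : X} {r r' : ℝ} (h : (y, r) ∈ μ.rateSet p) (hr : r' ≤ r) :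
    (y, r') ∈ μ.rateSet p := by
  obtain ⟨η, hη, R, hR, h⟩ := h
  exact ⟨η, hη, R, hr.trans_lt hR, h⟩

theorem isOpen_rateSet [TopologicalSpace X] [IsTopologicalAddGroup X] (hp : Continuous p) :
    IsOpen (μ.rateSet p) := by
  refine isOpen_iff_mem_nhds.2 fun q ⟨η, hη, R, hR, h⟩ => ?_
  have hball : ∀ᶠ q' : X × ℝ in 𝓝 q, η + p (q.1 - q'.1) < 1 :=
    (by fun_prop : Continuous fun q' : X × ℝ => η + p (q.1 - q'.1)).continuousAt.eventually_lt_const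
      (by simpa using hη)
  filter_upwards [hball, continuous_snd.continuousAt.eventually_lt_const hR] with q' hη' hR'
  exact h.mem_rateSet hη' hR'

theorem LowerAsymptoticallyDecoupled.convex_rateSet (hdec : μ.LowerAsymptoticallyDecoupled)
    (hd : 0 < d) (hmeas : ∀ y r, MeasurableSet (p.ball y r)) {t a : ℝ} (ha : 0 < a)
    (hspin : μ.SpinLowerBound (p.ball 0 t) a) : Convex ℝ (μ.rateSet p) := by
  rintro ⟨y₁, r₁⟩ ⟨η₁, hη₁, R₁, hR₁, h₁⟩ ⟨y₂, r₂⟩ ⟨η₂, hη₂, R₂, hR₂, h₂⟩ u v hu hv huv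
  have hR : u * r₁ + v * r₂ < u * R₁ + v * R₂ := by
    have hpos := convex_Ioi (0 : ℝ) (sub_pos.2 hR₁) (sub_pos.2 hR₂) hu hv huv
    simp only [Set.mem_Ioi, smul_eq_mul] at hpos
    linarith
  set η := max 0 (max η₁ η₂)
  have hη : η < 1 := max_lt one_pos (max_lt hη₁ hη₂)
  have h₁' : μ.RateAtLeast p y₁ η R₁ :=
    h₁.mono (Seminorm.ball_mono (le_max_of_le_right (le_max_left η₁ η₂))) le_rfl
  have h₂' : μ.RateAtLeast p y₂ η R₂ :=
    h₂.mono (Seminorm.ball_mono (le_max_of_le_right (le_max_right η₁ η₂))) le_rfl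
  set ybar := u • y₁ + v • y₂
  set R := u * R₁ + v * R₂
  obtain ⟨δ, hδ, hsmall⟩ := exists_pos_mul_lt
    (lt_min (sub_pos.2 hη) (sub_pos.2 hR)) (p ybar + |R| + 2)
  obtain ⟨hsmall_ball, hsmall_rate⟩ := lt_min_iff.1 hsmall
  obtain ⟨m, hm₁, hm₂, ρ, hρ, H⟩ :=
    (h₁'.and (h₂'.and (hdec.eventually_rateAtLeast hd hmeas ha hspin hδ))).exists
  have hM := card_sites_cube_pos d m
  have hsum := sumsNear_of_le_measure_ball (hmeas · η) hu hv huv hm₁ hm₂ hδ (mul_pos hM hδ)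
  rw [show u * ((cube d m).sites.card * R₁) + v * ((cube d m).sites.card * R₂) -
    (cube d m).sites.card * δ = (cube d m).sites.card * (R - δ) by ring] at hsum
  refine (H (by positivity) hsum).mem_rateSet (y' := ybar) ?_ ?_
  · have hdist : p (ρ • ybar - ybar) ≤ δ * p ybar := by
      rw [show ρ • ybar - ybar = (ρ - 1) • ybar by module, map_smul_eq_mul, Real.norm_eq_abs,
        abs_of_nonpos (by linarith [hρ.2])]
      exact mul_le_mul_of_nonneg_right (by linarith [hρ.1]) (apply_nonneg p _)
    linarith [mul_nonneg hδ.le (abs_nonneg R)]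
  · change u * r₁ + v * r₂ < ρ * (R - δ) - δ
    linarith [sub_mul_abs_le_mul hρ R, mul_le_of_le_one_left hδ.le hρ.2,
      mul_nonneg hδ.le (apply_nonneg p ybar)]

theorem le_liminf_log_cramer_of_mem_rateSet {x : X} {a : ℝ} (h : (x, a) ∈ μ.rateSet p) :
    (a : EReal) ≤ liminf (fun n : ℕ+ =>
      ENNReal.log (μ.cramer n (x +ᵥ p.ball 0 1)) / ((cube d n).sites.card : EReal)) atTop := by
  obtain ⟨η, hη, R, hR, h⟩ := h
  have hball : p.ball x η ⊆ x +ᵥ p.ball 0 1 := by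
    simpa [Seminorm.vadd_ball] using p.ball_mono (x := x) hη.le
  refine le_liminf_of_le (by isBoundedDefault) (Eventually.mono h fun n hn => ?_)
  rw [← ofReal_exp_le_iff_le_log_div (card_sites_pos _)]
  exact (ENNReal.ofReal_le_ofReal (by gcongr)).trans (hn.trans (measure_mono hball))

end InvariantSystem

end RateSet

section Pressure

open LatticeBox

variable {X : Type*} [AddCommGroup X] [Module ℝ X] [MeasurableSpace X] [TopologicalSpace X]
  {C₀ : Set (Set X)} {d : ℕ} {μ : InvariantSystem d X}

theorem ofReal_exp_mul_measure_le_lintegral {Ω : Type*} [MeasurableSpace Ω] (P : Measure Ω)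
    {A : Set Ω} (hA : MeasurableSet A) {f : Ω → ℝ} {β : ℝ} (hf : ∀ ω ∈ A, β ≤ f ω) :
    ENNReal.ofReal (Real.exp β) * P A ≤ ∫⁻ ω, ENNReal.ofReal (Real.exp (f ω)) ∂P := by
  rw [← setLIntegral_const]
  refine (setLIntegral_mono' hA fun ω hω => ?_).trans (setLIntegral_le_lintegral _ _)
  exact ENNReal.ofReal_le_ofReal (Real.exp_le_exp.2 (hf ω hω))

theorem InvariantSystem.entropy_le_pressure_sub (hX : IsMeasurableLCS C₀) (x : X)
    (l : X →L[ℝ] ℝ) : μ.entropy C₀ x ≤ μ.pressure l - ((l x : ℝ) : EReal) := by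
  by_contra! hlt
  obtain ⟨b, hpb, hbs⟩ := EReal.lt_iff_exists_real_btwn.1 hlt
  obtain ⟨b', hbb', hbs'⟩ := EReal.lt_iff_exists_real_btwn.1 hbs
  rw [EReal.coe_lt_coe_iff] at hbb'
  rw [EReal.sub_lt_iff (.inl (EReal.coe_ne_bot _)) (.inl (EReal.coe_ne_top _)),
    ← EReal.coe_add] at hpb
  obtain ⟨C, hC, hCl⟩ := hX.nhds_zero_basis.mem_iff.1
    (l.continuous.continuousAt.eventually_const_lt (show b - b' < l 0 by simpa using hbb'))
  obtain ⟨n, hlaw, hlaplace⟩ := ((eventually_lt_of_lt_liminf (hbs'.trans_le (iInf₂_le C hC))).and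
    (eventually_lt_of_limsup_lt hpb)).exists
  rw [← ofReal_exp_lt_iff_lt_log_div (card_sites_pos _)] at hlaw
  rw [← not_le, ← ofReal_exp_le_iff_le_log_div (card_sites_pos _)] at hlaplace
  refine hlaplace ?_
  set N : ℝ := ((cube d n).sites.card : ℝ)
  have hl : ∀ y ∈ x +ᵥ C, N * (l x + (b - b')) ≤ N * l y := by
    rintro _ ⟨c, hc, rfl⟩
    have hlc : b - b' < l c := hCl hc
    simp only [vadd_eq_add, map_add]
    gcongr
  calc ENNReal.ofReal (Real.exp (N * (b + l x)))
      = ENNReal.ofReal (Real.exp (N * (l x + (b - b')))) * ENNReal.ofReal (Real.exp (N * b')) := by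
        rw [← ENNReal.ofReal_mul (Real.exp_pos _).le, ← Real.exp_add]
        ring_nf
    _ ≤ ENNReal.ofReal (Real.exp (N * (l x + (b - b')))) * μ.cramer n (x +ᵥ C) := by gcongr
    _ ≤ _ := ofReal_exp_mul_measure_le_lintegral _
        (hX.measurableSet_vadd _ _ (hX.subset hC).2) hl

/-- Up to mass `ε`, the measure `P` is carried by finitely many translates of `C`, for all
`ε > 0` and `C ∈ C₀`. This is what remains of tightness when `P` need not be Borel. -/
def IsAlmostTotallyBounded (C₀ : Set (Set X)) (P : Measure X) : Prop :=
  ∀ C ∈ C₀, ∀ ε > 0, ∃ S : Finset X, P (⋃ y ∈ S, y +ᵥ C)ᶜ < ε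

variable [IsTopologicalAddGroup X] [ContinuousSMul ℝ X]

theorem IsMeasurableLCS.exists_seminorm_dominating (hX : IsMeasurableLCS C₀) {p : Seminorm ℝ X}
    (hp : Continuous p) (l : X →L[ℝ] ℝ) {c δ : ℝ} (hc : 0 < c) (hδ : 0 < δ) :
    ∃ q : Seminorm ℝ X, q.ball 0 1 ∈ C₀ ∧ (∀ x, p x ≤ c * q x) ∧ ∀ x, l x ≤ δ * q x := by
  obtain ⟨q, hq, hle⟩ := hX.exists_seminorm_ge
    (q := p.comp (c⁻¹ • LinearMap.id) + (normSeminorm ℝ ℝ).comp (δ⁻¹ • l : X →L[ℝ] ℝ).toLinearMap)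
    (show Continuous fun x => p (c⁻¹ • x) + ‖δ⁻¹ * l x‖ by fun_prop)
  have hle' : ∀ x, c⁻¹ * p x + δ⁻¹ * |l x| ≤ q x := fun x => by
    simpa [map_smul_eq_mul, abs_of_pos hc, abs_of_pos hδ] using hle x
  refine ⟨q, hq, fun x => ?_, fun x => ?_⟩
  · rw [← inv_mul_le_iff₀ hc]
    exact (le_add_of_nonneg_right (by positivity)).trans (hle' x)
  · rw [← inv_mul_le_iff₀ hδ]
    have := apply_nonneg p x
    have := le_abs_self (l x)
    refine le_trans ?_ ((le_add_of_nonneg_left (by positivity)).trans (hle' x))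
    gcongr

theorem InvariantSystem.exists_mem_rateSet_of_lt_pressure (hX : IsMeasurableLCS C₀) (hd : 0 < d)
    (hdec : μ.LowerAsymptoticallyDecoupled) {p : Seminorm ℝ X} (hp : Continuous p)
    (hp₀ : p.ball 0 1 ∈ C₀) {t a : ℝ} (ha : 0 < a) (hspin : μ.SpinLowerBound (p.ball 0 t) a)
    (htight : ∀ n, IsAlmostTotallyBounded C₀ (μ.cramer n)) {l : X →L[ℝ] ℝ} {b : ℝ}
    (hb : (b : EReal) < μ.pressure l) :
    ∃ y r, b < l y + r ∧ ∀ c ∈ p.ball 0 (1 / 4), (y + c, r) ∈ μ.rateSet p := by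
  obtain ⟨b₁, hbb₁, hb₁⟩ := EReal.lt_iff_exists_real_btwn.1 hb
  rw [EReal.coe_lt_coe_iff] at hbb₁
  obtain ⟨δ, hδ, hsmall⟩ := exists_pos_mul_lt (lt_min (sub_pos.2 hbb₁) one_pos) (|b₁| + 4)
  obtain ⟨hδb, hδ_one⟩ := lt_min_iff.1 hsmall
  obtain ⟨q, hq, hpq, hlq⟩ := hX.exists_seminorm_dominating hp l (c := 1 / 8) (by norm_num) hδ
  obtain ⟨m, hm, ρ, hρ, H⟩ := ((frequently_lt_of_lt_limsup (by isBoundedDefault) hb₁).and_eventually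
    (hdec.eventually_rateAtLeast hd (hX.measurableSet_ball hp₀) ha hspin hδ)).exists
  rw [← ofReal_exp_lt_iff_lt_log_div (card_sites_pos _)] at hm
  have hM := card_sites_cube_pos d m
  set M : ℝ := ((cube d m).sites.card : ℝ)
  obtain ⟨y, hy⟩ := exists_sumsNear_of_lt_lintegral_exp (p := q)
    (fun y => hX.measurableSet_ball hq y 1)
    (fun ε hε => by simpa [Seminorm.vadd_ball] using htight m _ hq ε hε)
    (l := (M • l : X →L[ℝ] ℝ).toLinearMap) (δ := M * δ)
    (hX.measurable_dual (M • l)) (by positivity)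
    (fun x => by simpa [mul_assoc] using mul_le_mul_of_nonneg_left (hlq x) hM.le)
    (by simpa using hm)
  have hsum := hy.of_seminorm_le (by norm_num) hpq
  rw [show M * b₁ - (M • l : X →L[ℝ] ℝ).toLinearMap y - 2 * (M * δ) = M * (b₁ - l y - 2 * δ) by
    simp only [ContinuousLinearMap.coe_coe, _root_.smul_apply, smul_eq_mul]; ring] at hsum
  have hrate := H (by norm_num) hsum
  refine ⟨ρ • y, ρ * (b₁ - l y - 2 * δ) - 2 * δ, ?_, fun c hc => hrate.mem_rateSet ?_ ?_⟩
  · rw [map_smul, smul_eq_mul]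
    linarith [sub_mul_abs_le_mul hρ b₁, mul_le_of_le_one_left hδ.le hρ.2]
  · rw [p.mem_ball_zero] at hc
    rw [sub_add_cancel_left, map_neg_eq_map]
    linarith [mul_nonneg (abs_nonneg b₁) hδ.le]
  · linarith

end Pressure

section Tightness

open LatticeBox

variable {X : Type*} {d : ℕ}

theorem setOf_exists_apply_notMem (S : Finset (Fin d → ℤ)) (K : Set X) :
    {σ : Config d X | ∃ z ∈ S, σ z ∉ K} = ⋃ z ∈ S, {σ | σ z ∈ K}ᶜ := by
  ext σ
  simp

variable [AddCommGroup X] [Module ℝ X]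

theorem empMean_mem {A : Set X} (hA : Convex ℝ A) {Λ : LatticeBox d} {σ : Config d X}
    (hσ : ∀ z ∈ Λ.sites, σ z ∈ A) : empMean Λ σ ∈ A := by
  have hcard : (Λ.sites.card : ℝ) ≠ 0 := by exact_mod_cast Λ.card_sites_pos.ne'
  rw [empMean, Finset.smul_sum]
  exact hA.sum_mem (fun _ _ => by positivity) (by simp [hcard]) hσ

variable [MeasurableSpace X] {μ : InvariantSystem d X}

namespace InvariantSystem

theorem LocallyControlled.exists_spinLowerBound (h : μ.LocallyControlled) {C : Set X}
    (hC : C ∈ measurableInternalConvexes X) :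
    ∃ t > (0 : ℝ), ∃ a > 0, μ.SpinLowerBound (t • C) a := by
  obtain ⟨t, α, h⟩ := h
  obtain ⟨ht, hα, h⟩ := h C hC
  exact ⟨t C, ht, α C, hα, fun Λ hΛ => h Λ Λ subset_rfl hΛ⟩

theorem SpinLowerBound.law_compl_le {K : Set X} {γ : ℝ} (h : μ.SpinLowerBound K (1 - γ))
    (hK : MeasurableSet K) {Λ : LatticeBox d} {z : Fin d → ℤ} (hz : z ∈ Λ.sites) :
    μ.law Λ {σ | σ z ∈ K}ᶜ ≤ ENNReal.ofReal γ := by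
  have hle := h.ofReal_mul_law_le hK hz (Finset.empty_subset _) (Finset.notMem_empty z)
    (@MeasurableSet.univ _ (fieldSigma X ∅))
  rw [μ.law_univ, mul_one, Set.inter_univ] at hle
  have hKz : MeasurableSet[fieldSigma X Λ.sites] {σ : Config d X | σ z ∈ K} :=
    measurable_eval hz hK
  rw [@prob_compl_eq_one_sub _ (fieldSigma X Λ.sites) _ _ (μ.isProbabilityMeasure_law Λ) hKz,
    tsub_le_iff_left]
  calc (1 : ℝ≥0∞) = ENNReal.ofReal ((1 - γ) + γ) := by simp
    _ ≤ ENNReal.ofReal (1 - γ) + ENNReal.ofReal γ := ENNReal.ofReal_add_le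
    _ ≤ _ := by gcongr

theorem SpinLowerBound.law_exists_notMem_le {K : Set X} {γ : ℝ} (h : μ.SpinLowerBound K (1 - γ))
    (hK : MeasurableSet K) (Λ : LatticeBox d) :
    μ.law Λ {σ | ∃ z ∈ Λ.sites, σ z ∉ K} ≤ Λ.sites.card * ENNReal.ofReal γ := by
  calc μ.law Λ {σ | ∃ z ∈ Λ.sites, σ z ∉ K} ≤ ∑ z ∈ Λ.sites, μ.law Λ {σ | σ z ∈ K}ᶜ := by
        rw [setOf_exists_apply_notMem]
        exact measure_biUnion_finset_le _ _
    _ ≤ ∑ _z ∈ Λ.sites, ENNReal.ofReal γ := Finset.sum_le_sum fun z hz => h.law_compl_le hK hz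
    _ = Λ.sites.card * ENNReal.ofReal γ := by rw [Finset.sum_const, nsmul_eq_mul]

theorem CarriedBy.cramer_compl_le {D : Set X} (hD : μ.CarriedBy (fieldsIn d D)) {K : Set X}
    (hK : MeasurableSet K) (hKD : Convex ℝ (K ∩ D)) {γ : ℝ} (h : μ.SpinLowerBound K (1 - γ))
    {U : Set X} (hU : MeasurableSet U) (hKU : K ∩ D ⊆ U) (n : ℕ+) :
    μ.cramer n Uᶜ ≤ (cube d n).sites.card * ENNReal.ofReal γ := by
  have hmean : MeasurableSet[fieldSigma X (cube d n).sites]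
      (empMean (cube d n) ⁻¹' Uᶜ : Set (Config d X)) := measurable_empMean subset_rfl hU.compl
  have hout : MeasurableSet[fieldSigma X (cube d n).sites]
      {σ : Config d X | ∃ z ∈ (cube d n).sites, σ z ∉ K} := by
    rw [setOf_exists_apply_notMem]
    exact @Finset.measurableSet_biUnion _ _ (fieldSigma X _) _ _ fun z hz =>
      measurable_eval hz hK.compl
  rw [μ.cramer_apply_eq_law subset_rfl hU.compl, hD _ _ _ hmean
    (@MeasurableSet.inter _ (fieldSigma X _) _ _ hmean hout)]
  · exact (measure_mono Set.inter_subset_right).trans (h.law_exists_notMem_le hK _)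
  · ext σ
    refine and_congr_left fun hσ => iff_self_and.2 fun hσU => ?_
    by_contra hσK
    have hσK' : ∀ z ∈ (cube d n).sites, σ z ∈ K := by simpa using hσK
    exact hσU (hKU (empMean_mem hKD fun z hz => ⟨hσK' z hz, hσ z⟩))

theorem LocallyConvexTight.isAlmostTotallyBounded_cramer [TopologicalSpace X]
    [IsTopologicalAddGroup X] {C₀ : Set (Set X)} (hX : IsMeasurableLCS C₀) {D : Set X}
    (h : μ.LocallyConvexTight D) (hD : μ.CarriedBy (fieldsIn d D)) (n : ℕ+) :
    IsAlmostTotallyBounded C₀ (μ.cramer n) := by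
  intro C hC ε hε
  obtain ⟨γ, hγ, hγε⟩ := ENNReal.exists_nnreal_pos_mul_lt
    (ENNReal.natCast_ne_top (cube d n).sites.card) hε.ne'
  obtain ⟨K, hK, hKD, hcompact, hspin⟩ := h γ hγ
  obtain ⟨S, -, hS⟩ := hcompact.elim_nhds_subcover (fun y => y +ᵥ C) fun y _ =>
    vadd_mem_nhds_self.2 (hX.nhds_zero_basis.mem_of_mem hC)
  refine ⟨S, (hD.cramer_compl_le hK hKD hspin ?_ (subset_closure.trans hS) n).trans_lt ?_⟩
  · exact S.measurableSet_biUnion fun y _ => hX.measurableSet_vadd y C (hX.subset hC).2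
  · rwa [ENNReal.ofReal_coe_nnreal, mul_comm]

end InvariantSystem

end Tightness

open InvariantSystem in
theorem mainTheorem4_general {X : Type*} [AddCommGroup X] [Module ℝ X] [TopologicalSpace X]
    [IsTopologicalAddGroup X] [ContinuousSMul ℝ X] [MeasurableSpace X]
    {C₀ : Set (Set X)} (hX : IsMeasurableLCS C₀) {d : ℕ} (hd : 0 < d) (μ : InvariantSystem d X)
    (h_dec : μ.LowerAsymptoticallyDecoupled)
    (h_ctrl : ∀ C ∈ C₀, ∃ t > (0 : ℝ), ∃ a > 0, μ.SpinLowerBound (t • C) a)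
    (h_tight : ∀ n, IsAlmostTotallyBounded C₀ (μ.cramer n)) (x : X) :
    μ.entropy C₀ x = ⨅ l : X →L[ℝ] ℝ, (μ.pressure l - ((l x : ℝ) : EReal)) := by
  refine le_antisymm (le_iInf fun l => μ.entropy_le_pressure_sub hX x l)
    (le_iInf₂ fun C hC => EReal.ge_of_forall_gt_iff_ge.1 fun a ha => ?_)
  obtain ⟨p, hp, rfl⟩ := hX.exists_seminorm hC
  obtain ⟨t, ht, α, hα, hspin⟩ := h_ctrl _ hC
  rw [Seminorm.smul_ball_zero ht.ne', Real.norm_eq_abs, abs_of_pos ht, mul_one] at hspin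
  have hconv := h_dec.convex_rateSet hd (hX.measurableSet_ball hC) hα hspin
  refine le_liminf_log_cramer_of_mem_rateSet (mem_of_forall_exists_lt (isOpen_rateSet hp) hconv
    mem_rateSet_of_le nonpos_of_mem_rateSet (Seminorm.ball_mem_nhds hp (by norm_num)) fun l =>
      μ.exists_mem_rateSet_of_lt_pressure hX hd h_dec hp hC hα hspin h_tight ?_)
  have hl := ha.trans_le (iInf_le _ l)
  rw [EReal.lt_sub_iff_add_lt (.inl (EReal.coe_ne_bot _)) (.inl (EReal.coe_ne_top _))] at hl
  exact_mod_cast hl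

theorem mainTheorem4 {X : Type*} [AddCommGroup X] [Module ℝ X] [TopologicalSpace X]
    [IsTopologicalAddGroup X] [ContinuousSMul ℝ X] [MeasurableSpace X]
    (C₀ : Set (Set X)) (hX : IsMeasurableLCS C₀)
    (d : ℕ) (hd : 0 < d) (μ : InvariantSystem d X)
    (D : Set X) (hD : Convex ℝ D)
    (h_dec : μ.LowerAsymptoticallyDecoupled)
    (h_ctrl : μ.LocallyControlled)
    (h_carried : μ.CarriedBy (fieldsIn d D))
    (h_tight : μ.LocallyConvexTight D) (x : X) :
    μ.entropy C₀ x = ⨅ l : X →L[ℝ] ℝ, (μ.pressure l - ((l x : ℝ) : EReal)) :=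
  mainTheorem4_general hX hd μ h_dec (fun _ hC => h_ctrl.exists_spinLowerBound (hX.subset hC))
    (h_tight.isAlmostTotallyBounded_cramer hX h_carried) x
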